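/- **Setting.** Let $a<b$ be real. A quadrature rule on $[a,b]$ is $Q(f)=\sum_{j=1}^m w_j f(x_j)$ with nodes $x_j\in[a,b]$ and real weights $w_j$; it has positive weights if all $w_j>0$, and it is of order $\nu\ge 1$ if $Q(p)=\int_a^b p(x)\,dx$ for all polynomials $p$ of degree at most $\nu-1$. For a continuous kernel $K:[a,b]^2\to\mathbb C$ and $z\in\mathbb C$ define the Fredholm determinant and its Nyström-type approximation by $$d(z)=1+\sum_{n=1}^\infty \frac{z^n}{n!}\int_{[a,b]^n}\det\big(K(t_p,t_q)\big)_{p,q=1}^n\,dt_1\cdots dt_n,\qquad d_Q(z)=\det\big(\delta_{ij}+z\,w_iK(x_i,x_j)\big)_{i,j=1}^m ,$$ and put $$\Phi(x)=\sum_{n=1}^\infty\frac{n^{(n+2)/2}}{n!}\,x^n .$$ For $k\ge1$, $C^{k-1,1}$ denotes the functions that are $k-1$ times continuously differentiable with Lipschitz continuous derivatives of order $k-1$; for $K\in C^{k-1,1}([a,b]^2)$ let $$\|K\|_k=\max_{i+j\le k}\|\partial_1^i\partial_2^jK\|_{L^\infty((a,b)^2)}$$ (derivatives of order $k$ exist almost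 everywhere). **Theorem.** (i) There are constants $c_k$ ($k=1,2,\dots$), depending only on $k$, such that for every $k\geq 1$ the one-dimensional error estimate $$\Big|Q(f)-\int_a^b f(x)\,dx\Big|\le c_k\,(b-a)^{k+1}\nu^{-k}\,\|f^{(k)}\|_{L^\infty(a,b)}$$ holds for all $a<b$, all $f\in C^{k-1,1}[a,b]$ and all quadrature rules $Q$ of order $\nu\ge k$ with positive weights, and such that, with the same constant $c_k$, $$|d_Q(z)-d(z)|\le c_k\,2^k(b-a)^k\nu^{-k}\,\Phi\big(|z|(b-a)\|K\|_k\big)$$ holds for all $a<b$, all $K\in C^{k-1,1}([a,b]^2)$, all quadrature rules $Q$ on $[a,b]$ of order $\nu\ge k$ with positive weights, and all $z\in\mathbb C$. (ii) Let $a<b$ and let $\mathcal E_\rho\subset\mathbb C$ be the open region bounded by the ellipse with foci $a,b$ and semiaxes of lengths $s>\sigma>0$, where $\rho=\sqrt{(s+\sigma)/(s-\sigma)}$. If $K$ is bounded and analytic on $\mathcal E_\rho\times\mathcal E_\rho$, then for every quadrature rule $Q$ on $[a,b]$ of order $\nu\geq 1$ with positive weights and every $z\in\mathbb C$ $$|d_Q(z)-d(z)|\le\frac{4\,\rho^{-\nu}}{1-\rho^{-1}}\,\Phi\big(|z|(b-a)\|K\|_{L^\infty(\mathcal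 E_\rho\times\mathcal E_\rho)}\big).$$ -/

import Mathlib

open MeasureTheory
open scoped ENNReal

noncomputable section

namespace NystromFredholm

/-- A quadrature rule `Q(f) = ∑_j w_j f(x_j)` with finitely many nodes in `[a, b]`. -/
structure QuadratureRule (a b : ℝ) where
  /-- the number of nodes -/
  m : ℕ
  /-- the weights -/
  w : Fin m → ℝ
  /-- the nodes -/
  x : Fin m → ℝ
  x_mem : ∀ j, x j ∈ Set.Icc a b

namespace QuadratureRule

variable {a b : ℝ}

/-- The value `Q(f) = ∑_j w_j f(x_j)` for a complex valued function `f`. -/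
def apply (Q : QuadratureRule a b) (f : ℝ → ℂ) : ℂ :=
  ∑ j, (Q.w j : ℂ) * f (Q.x j)

/-- All weights are positive. -/
def PositiveWeights (Q : QuadratureRule a b) : Prop :=
  ∀ j, 0 < Q.w j

/-- `Q` is of order `ν ≥ 1`: it integrates exactly all polynomials of degree at most `ν - 1`. -/
def HasOrder (Q : QuadratureRule a b) (ν : ℕ) : Prop :=
  1 ≤ ν ∧ ∀ p : Polynomial ℝ, p.natDegree ≤ ν - 1 →
    ∑ j, Q.w j * p.eval (Q.x j) = ∫ t in a..b, p.eval t

/-- The Nyström-type approximation `d_Q(z) = det(δ_ij + z w_i K(x_i, x_j))`. -/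
def nystromDet (Q : QuadratureRule a b) (K : ℝ × ℝ → ℂ) (z : ℂ) : ℂ :=
  Matrix.det (Matrix.of fun i j : Fin Q.m =>
    (if i = j then 1 else 0) + z * (Q.w i : ℂ) * K (Q.x i, Q.x j))

end QuadratureRule

/-- `K_n(t_1, …, t_n) = det(K(t_p, t_q))_{p,q}`. -/
def kernelDet (K : ℝ × ℝ → ℂ) (n : ℕ) (t : Fin n → ℝ) : ℂ :=
  Matrix.det (Matrix.of fun p q : Fin n => K (t p, t q))

/-- The Fredholm determinant
`d(z) = 1 + ∑_{n ≥ 1} z^n / n! ∫_{[a,b]^n} K_n(t_1, …, t_n) dt_1 ⋯ dt_n`. -/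
def fredholmDet (a b : ℝ) (K : ℝ × ℝ → ℂ) (z : ℂ) : ℂ :=
  1 + ∑' n : ℕ, z ^ (n + 1) / ((n + 1).factorial : ℂ) *
    ∫ t in Set.univ.pi (fun _ : Fin (n + 1) => Set.Icc a b), kernelDet K (n + 1) t

/-- The function `Φ(x) = ∑_{n ≥ 1} n^{(n+2)/2} / n! x^n` on the real line. -/
def Phi (x : ℝ) : ℝ :=
  ∑' n : ℕ, ((n + 1 : ℕ) : ℝ) ^ ((((n + 1 : ℕ) : ℝ) + 2) / 2) / ((n + 1).factorial : ℝ)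
    * x ^ (n + 1)

/-- The class `C^{n,1}(S)`, for `S` a compact box: `f` is `n` times continuously differentiable
on `S` and its `n`-th derivative is Lipschitz continuous on `S`. -/
def ContDiffLip {E : Type*} [NormedAddCommGroup E] [NormedSpace ℝ E]
    (n : ℕ) (f : E → ℂ) (S : Set E) : Prop :=
  ContDiffOn ℝ n f S ∧ ∃ L : NNReal, LipschitzOnWith L (iteratedFDerivWithin ℝ n f S) S

/-- The `L^∞(S)` norm with respect to Lebesgue measure, in `[0, ∞]`. -/
def linftyENorm {α : Type*} [MeasureSpace α] (f : α → ℂ) (S : Set α) : ℝ≥0∞ :=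
  eLpNorm f ∞ (volume.restrict S)

/-- The partial derivative `∂_1^i ∂_2^j K`. For `K` of class `C^{k-1,1}` on a square it exists at
every interior point if `i + j < k` and at almost every point if `i + j = k`. -/
def partialDeriv (i j : ℕ) (K : ℝ × ℝ → ℂ) (p : ℝ × ℝ) : ℂ :=
  iteratedDeriv i (fun x => iteratedDeriv j (fun y => K (x, y)) p.2) p.1

/-- The norm `‖K‖_k = max_{i+j ≤ k} ‖∂_1^i ∂_2^j K‖_{L^∞}` of a kernel on `[a, b]²`. -/
def kernelNorm (a b : ℝ) (k : ℕ) (K : ℝ × ℝ → ℂ) : ℝ :=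
  (⨆ (i : ℕ) (j : ℕ) (_ : i + j ≤ k),
    linftyENorm (partialDeriv i j K) (Set.Ioo a b ×ˢ Set.Ioo a b)).toReal

/-- `c` is a valid constant in the one-dimensional error estimate
`|Q(f) - ∫_a^b f| ≤ c (b-a)^{k+1} ν^{-k} ‖f^{(k)}‖_{L^∞(a,b)}`, simultaneously for all intervals
`[a, b]`, all `f ∈ C^{k-1,1}[a, b]` and all rules `Q` of order `ν ≥ k` with positive weights. -/
def IsQuadratureErrorConstant (k : ℕ) (c : ℝ) : Prop :=
  ∀ (a b : ℝ), a < b → ∀ f : ℝ → ℂ, ContDiffLip (k - 1) f (Set.Icc a b) →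
    ∀ (Q : QuadratureRule a b) (ν : ℕ), Q.PositiveWeights → Q.HasOrder ν → k ≤ ν →
      ‖Q.apply f - ∫ t in a..b, f t‖ ≤
        c * (b - a) ^ (k + 1) * ((ν : ℝ) ^ k)⁻¹ *
          (linftyENorm (iteratedDeriv k f) (Set.Ioo a b)).toReal

/-- The open region in `ℂ` bounded by the ellipse with centre `(a + b) / 2` and semiaxes of lengths
`s` (parallel to the real axis) and `σ`. Its foci are `a` and `b` if and only if
`s² - σ² = ((b - a) / 2)²`. -/
def ellipse (a b s σ : ℝ) : Set ℂ :=
  {ζ | ((ζ.re - (a + b) / 2) / s) ^ 2 + (ζ.im / σ) ^ 2 < 1}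

end NystromFredholm

end

open MeasureTheory
open scoped ENNReal

namespace NystromFredholm

/-! ### Hadamard's inequality -/

/-! Von Koch's formula writes `d_Q(z)` as the series with terms `z^n / n!` times `Q^n(K_n)`, where
`Q^n` is the tensor product rule on the cube and `K_n` is the determinant in the Fredholm series
(`QuadratureRule.hasSum_nystromDet`). The two determinants therefore differ, term by term, by the
error of `Q^n` on `K_n`.

Positive weights of total mass `b - a` let that error be split, one variable at a time, into `n`
one-dimensional errors (`norm_applyPi_sub_integral_le`). Exactness on polynomials of degree below
`ν`, again with positivity, bounds a one-dimensional error by `2 (b - a)` times the distance to such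
polynomials (`norm_apply_sub_integral_le_of_approx`). If each one-dimensional error is at most `(b -
a) δ n^{n/2} N^n`, the sum over the `n` variables gives the coefficient `n^{(n+2)/2}` of `Φ`
(`norm_nystromDet_sub_fredholmDet_le`).

What remains is to approximate `K_n` as a function of one variable. That variable occurs in one row
and one column, so each derivative splits a determinant into two; Hadamard's inequality bounds every
piece and gives the factor `2^k n^{n/2} ‖K‖_k^n` (`KernelJet.diffLip_det`). Jackson's theorem with a
Lipschitz derivative of order `k - 1` then yields the rate `ν^{-k}`, and both halves of (i) share
their constant because both use this one-dimensional estimate.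

For an analytic kernel, `K_n` extends holomorphically in the one variable to the ellipse, with
Hadamard's bound, and truncating its Chebyshev expansion gives the geometric rate
(`norm_apply_sub_integral_le_of_ellipse`). -/

open scoped ComplexOrder in
theorem norm_det_le_of_entries_le_one {n : ℕ} (A : Matrix (Fin n) (Fin n) ℂ)
    (h : ∀ i j, ‖A i j‖ ≤ 1) : ‖A.det‖ ≤ (n : ℝ) ^ ((n : ℝ) / 2) := by
  rcases Nat.eq_zero_or_pos n with rfl | hn
  · simp
  have hn' : (0 : ℝ) < n := by exact_mod_cast hn
  -- The eigenvalues of the Gram matrix are nonnegative, have product `‖det A‖²` and sum at most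
  -- `n²`; the inequality of the means gives `‖det A‖² ≤ n^n`.
  have hB : (A * A.conjTranspose).PosSemidef := Matrix.posSemidef_self_mul_conjTranspose A
  have hdet : ‖A.det‖ ^ 2 = ∏ i, hB.1.eigenvalues i := by
    have h1 := hB.1.det_eq_prod_eigenvalues
    rw [Matrix.det_mul, Matrix.det_conjTranspose] at h1
    have h2 := congrArg norm h1
    rw [norm_mul, norm_star, ← sq] at h2
    rw [h2, ← map_prod, RCLike.norm_ofReal,
      abs_of_nonneg (Finset.prod_nonneg fun i _ => hB.eigenvalues_nonneg i)]
  have htr : ∑ i, hB.1.eigenvalues i ≤ n * n := by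
    have h1 := hB.1.trace_eq_sum_eigenvalues
    have h2 := congrArg norm h1
    rw [← map_sum, RCLike.norm_ofReal,
      abs_of_nonneg (Finset.sum_nonneg fun i _ => hB.eigenvalues_nonneg i)] at h2
    rw [← h2, Matrix.trace]
    refine (norm_sum_le _ _).trans ?_
    calc ∑ i : Fin n, ‖(A * A.conjTranspose).diag i‖ ≤ ∑ i : Fin n, (n : ℝ) := by
          refine Finset.sum_le_sum fun i _ => ?_
          rw [Matrix.diag_apply, Matrix.mul_apply]
          refine (norm_sum_le _ _).trans ?_
          calc ∑ j, ‖A i j * A.conjTranspose j i‖ ≤ ∑ j : Fin n, (1 : ℝ) := by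
                refine Finset.sum_le_sum fun j _ => ?_
                rw [norm_mul, Matrix.conjTranspose_apply, norm_star]
                exact mul_le_one₀ (h i j) (norm_nonneg _) (h i j)
            _ = n := by simp
      _ = n * n := by simp
  have hamgm := Real.geom_mean_le_arith_mean Finset.univ (fun _ : Fin n => (1 : ℝ))
    hB.1.eigenvalues (fun _ _ => zero_le_one) (by simpa using hn)
    (fun i _ => hB.eigenvalues_nonneg i)
  simp only [Real.rpow_one, Finset.sum_const, Finset.card_univ, Fintype.card_fin, nsmul_eq_mul,
    mul_one, one_mul] at hamgm
  rw [← hdet] at hamgm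
  have h3 : (‖A.det‖ ^ 2) ^ ((n : ℝ)⁻¹) ≤ n :=
    hamgm.trans ((div_le_iff₀ hn').2 htr)
  have h4 : ‖A.det‖ ^ 2 ≤ (n : ℝ) ^ n := by
    have := pow_le_pow_left₀ (by positivity) h3 n
    rwa [Real.rpow_inv_natCast_pow (by positivity) hn.ne'] at this
  have h5 : ((n : ℝ) ^ ((n : ℝ) / 2)) ^ 2 = (n : ℝ) ^ n := by
    rw [← Real.rpow_natCast _ 2, ← Real.rpow_mul hn'.le, ← Real.rpow_natCast]
    congr 1
    push_cast
    ring
  exact le_of_sq_le_sq (h5 ▸ h4) (by positivity)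

/-- Hadamard's inequality in terms of bounds on the entries of each row. -/
theorem norm_det_le_prod {n : ℕ} (A : Matrix (Fin n) (Fin n) ℂ) (r : Fin n → ℝ)
    (h : ∀ i j, ‖A i j‖ ≤ r i) : ‖A.det‖ ≤ (n : ℝ) ^ ((n : ℝ) / 2) * ∏ i, r i := by
  have hr : ∀ i, 0 ≤ r i := fun i => (norm_nonneg _).trans (h i i)
  -- If `r i = 0`, row `i` vanishes, so the convention `x / 0 = 0` does no harm.
  have hA : A = Matrix.of fun i j => (r i : ℂ) * (A i j / r i) := by
    ext i j
    rcases eq_or_ne (r i) 0 with h0 | h0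
    · have := h i j
      rw [h0, norm_le_zero_iff] at this
      simp [this]
    · simp [mul_div_cancel₀, h0]
  have hdet : A.det = (∏ i, (r i : ℂ)) * (Matrix.of fun i j => A i j / (r i : ℂ)).det := by
    conv_lhs => rw [hA]
    exact Matrix.det_mul_column (fun i => (r i : ℂ)) (Matrix.of fun i j => A i j / (r i : ℂ))
  rw [hdet, norm_mul, norm_prod, mul_comm]
  refine mul_le_mul (norm_det_le_of_entries_le_one _ fun i j => ?_)
    (le_of_eq ?_) (by positivity) (by positivity)
  · rw [Matrix.of_apply, norm_div, Complex.norm_real, Real.norm_of_nonneg (hr i)]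
    exact div_le_one_of_le₀ (h i j) (hr i)
  · exact Finset.prod_congr rfl fun i _ => by rw [Complex.norm_real, Real.norm_of_nonneg (hr i)]

theorem norm_det_le_pow {n : ℕ} (A : Matrix (Fin n) (Fin n) ℂ) (M : ℝ)
    (h : ∀ i j, ‖A i j‖ ≤ M) : ‖A.det‖ ≤ (n : ℝ) ^ ((n : ℝ) / 2) * M ^ n := by
  simpa using norm_det_le_prod A (fun _ => M) h

/-! ### The expansion of `det (1 + z A)` in principal minors -/

/-- A non-injective `x` repeats a row and contributes nothing. The injective `x` with image `s` are
the `k!` enumerations of `s`, and a principal minor does not change when rows and columns are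
permuted together. -/
theorem sum_det_submatrix {ι : Type*} [Fintype ι] [DecidableEq ι] (A : Matrix ι ι ℂ) (k : ℕ) :
    ∑ x : Fin k → ι, (A.submatrix x x).det = (k.factorial : ℂ) *
      ∑ s ∈ Finset.univ.powersetCard k,
        (A.submatrix (Subtype.val : s → ι) (Subtype.val : s → ι)).det := by
  classical
  have h1 : ∑ x : Fin k → ι, (A.submatrix x x).det
      = ∑ x ∈ Finset.univ.filter (fun x : Fin k → ι => Function.Injective x),
          (A.submatrix x x).det := by
    refine (Finset.sum_subset (Finset.filter_subset _ _) fun x _ hx => ?_).symm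
    have hx' : ¬ Function.Injective x := by simpa using hx
    simp only [Function.Injective, not_forall] at hx'
    replace hx := hx'
    obtain ⟨i, j, hij, hne⟩ := hx
    exact Matrix.det_zero_of_row_eq hne (by ext l; simp [hij])
  rw [h1, ← Finset.sum_fiberwise_of_maps_to (t := Finset.univ.powersetCard k)
    (g := fun x => Finset.univ.image x), Finset.mul_sum]
  · refine Finset.sum_congr rfl fun s hs => ?_
    rw [Finset.mem_powersetCard] at hs
    have key : ∀ x ∈ (Finset.univ.filter (fun x : Fin k → ι => Function.Injective x)).filter
        (fun x => Finset.univ.image x = s), (A.submatrix x x).det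
          = (A.submatrix (Subtype.val : s → ι) (Subtype.val : s → ι)).det := by
      intro x hx
      simp only [Finset.mem_filter, Finset.mem_univ, true_and] at hx
      have hmem : ∀ i, x i ∈ s := fun i => hx.2 ▸ Finset.mem_image_of_mem _ (Finset.mem_univ i)
      have hbij : Function.Bijective (fun i => (⟨x i, hmem i⟩ : s)) := by
        refine ⟨fun i j h => hx.1 (congrArg Subtype.val h), fun y => ?_⟩
        have hy : (y : ι) ∈ Finset.univ.image x := by rw [hx.2]; exact y.2
        obtain ⟨i, _, hi⟩ := Finset.mem_image.1 hy
        exact ⟨i, Subtype.ext hi⟩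
      rw [← Matrix.det_submatrix_equiv_self (Equiv.ofBijective _ hbij)]
      rfl
    rw [Finset.sum_congr rfl key, Finset.sum_const, nsmul_eq_mul]
    congr 2
    have hcard : Fintype.card (Fin k ≃ s) = k.factorial := by
      rw [Fintype.card_equiv (Fintype.equivOfCardEq (by simp [hs.2])), Fintype.card_fin]
    rw [← hcard, ← Finset.card_univ]
    symm
    refine Finset.card_bij (fun e _ => fun i => (e i : ι)) ?_ ?_ ?_
    · intro e _
      simp only [Finset.mem_filter, Finset.mem_univ, true_and]
      refine ⟨Subtype.val_injective.comp e.injective, ?_⟩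
      ext y
      simp only [Finset.mem_image, Finset.mem_univ, true_and]
      refine ⟨?_, fun hy => ⟨e.symm ⟨y, hy⟩, by simp⟩⟩
      rintro ⟨i, rfl⟩
      exact (e i).2
    · intro e _ e' _ h
      ext i
      exact congrFun h i
    · intro x hx
      simp only [Finset.mem_filter, Finset.mem_univ, true_and] at hx
      have hmem : ∀ i, x i ∈ s := fun i => hx.2 ▸ Finset.mem_image_of_mem _ (Finset.mem_univ i)
      have hbij : Function.Bijective (fun i => (⟨x i, hmem i⟩ : s)) := by
        refine ⟨fun i j h => hx.1 (congrArg Subtype.val h), fun y => ?_⟩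
        have hy : (y : ι) ∈ Finset.univ.image x := by rw [hx.2]; exact y.2
        obtain ⟨i, _, hi⟩ := Finset.mem_image.1 hy
        exact ⟨i, Subtype.ext hi⟩
      exact ⟨Equiv.ofBijective _ hbij, Finset.mem_univ _, rfl⟩
  · intro x hx
    simp only [Finset.mem_filter, Finset.mem_univ, true_and] at hx
    simp [Finset.mem_powersetCard, Finset.card_image_of_injective _ hx]

/-- Von Koch's formula. -/
theorem hasSum_det_one_add_smul {ι : Type*} [Fintype ι] [DecidableEq ι] (A : Matrix ι ι ℂ)
    (z : ℂ) :
    HasSum (fun n : ℕ => z ^ n / (n.factorial : ℂ) * ∑ x : Fin n → ι, (A.submatrix x x).det)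
      (1 + z • A).det := by
  open Polynomial in
  -- The coefficient of `X^n` is the sum of the principal minors of size `n`; the factor `n!` from
  -- counting ordered tuples cancels. The series is a polynomial in `z`, so it terminates.
  have hcoeff := Matrix.coeff_det_one_add_X_smul_eq_sum_minors A
  set p : Polynomial ℂ := Matrix.det (1 + (Polynomial.X : Polynomial ℂ) • A.map Polynomial.C)
  have hterm : ∀ n : ℕ, z ^ n / (n.factorial : ℂ) * ∑ x : Fin n → ι, (A.submatrix x x).det
      = p.coeff n * z ^ n := by
    intro n
    have : (n.factorial : ℂ) ≠ 0 := by exact_mod_cast n.factorial_ne_zero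
    rw [sum_det_submatrix, hcoeff]
    field_simp
  have heval : (1 + z • A).det = p.eval z := by
    rw [← Polynomial.coe_evalRingHom, RingHom.map_det]
    congr 1
    ext i j
    by_cases hij : i = j <;> simp [hij] <;> ring
  simp_rw [hterm]
  rw [heval, Polynomial.eval_eq_sum_range]
  refine hasSum_sum_of_ne_finset_zero fun n hn => ?_
  rw [Polynomial.coeff_eq_zero_of_natDegree_lt (by simpa using hn), zero_mul]

/-! ### The function `Φ` -/

/-- The square of the general term `T` is at most `(4 e x²)^n / n!`, by `n^n ≤ e^n n!` and `n² ≤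
4^n`. The weighted inequality `T ≤ (2^{-n} + 2^n T²) / 2` then removes the square and leaves two
summable series. -/
theorem summable_Phi {x : ℝ} (hx : 0 ≤ x) :
    Summable fun n : ℕ => (n : ℝ) ^ (((n : ℝ) + 2) / 2) / (n.factorial : ℝ) * x ^ n := by
  have hs : Summable fun n : ℕ => (1 / 2 : ℝ) * ((1 / 2) ^ n
      + (8 * Real.exp 1 * x ^ 2) ^ n / n.factorial) :=
    ((summable_geometric_of_lt_one (by norm_num) (by norm_num)).add
      (Real.summable_pow_div_factorial _)).mul_left _
  refine Summable.of_nonneg_of_le (fun n => by positivity) (fun n => ?_) hs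
  rcases Nat.eq_zero_or_pos n with rfl | hn
  · simp
  have hn' : (0 : ℝ) < n := by exact_mod_cast hn
  have hf : (0 : ℝ) < n.factorial := by exact_mod_cast n.factorial_pos
  set T := (n : ℝ) ^ (((n : ℝ) + 2) / 2) / (n.factorial : ℝ) * x ^ n with hT
  have hT0 : 0 ≤ T := by positivity
  have hpow : (n : ℝ) ^ n ≤ Real.exp 1 ^ n * n.factorial := by
    have := Real.pow_div_factorial_le_exp (n : ℝ) hn'.le n
    rw [div_le_iff₀ hf] at this
    rwa [← Real.exp_nat_mul, mul_one]
  have hn2 : (n : ℝ) ^ 2 ≤ 4 ^ n := by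
    have : (n : ℝ) ≤ 2 ^ n := by exact_mod_cast (Nat.lt_two_pow_self (n := n)).le
    calc (n : ℝ) ^ 2 ≤ (2 ^ n) ^ 2 := by gcongr
      _ = 4 ^ n := by rw [← pow_mul, mul_comm, pow_mul]; norm_num
  have hT2 : T ^ 2 ≤ (4 * Real.exp 1 * x ^ 2) ^ n / n.factorial := by
    have e1 : ((n : ℝ) ^ (((n : ℝ) + 2) / 2)) ^ 2 = (n : ℝ) ^ n * (n : ℝ) ^ 2 := by
      rw [← Real.rpow_natCast _ 2, ← Real.rpow_mul hn'.le, ← Real.rpow_natCast _ n,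
        ← Real.rpow_natCast _ 2, ← Real.rpow_add hn']
      congr 1
      push_cast
      ring
    rw [hT, mul_pow, div_pow, e1, div_mul_eq_mul_div, div_le_div_iff₀ (by positivity) hf]
    calc (n : ℝ) ^ n * (n : ℝ) ^ 2 * (x ^ n) ^ 2 * n.factorial
        ≤ (Real.exp 1 ^ n * n.factorial) * 4 ^ n * (x ^ n) ^ 2 * n.factorial := by gcongr
      _ = (4 * Real.exp 1 * x ^ 2) ^ n * (n.factorial : ℝ) ^ 2 := by ring
  have hle : T ≤ (1 / 2 : ℝ) * ((1 / 2) ^ n + 2 ^ n * T ^ 2) := by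
    have h2 : (1 / 2 : ℝ) ^ n * 2 ^ n = 1 := by rw [← mul_pow]; norm_num
    have h3 : (0 : ℝ) < (1 / 2) ^ n := by positivity
    nlinarith [sq_nonneg ((1 / 2 : ℝ) ^ n - T), sq_nonneg ((1 / 2 : ℝ) ^ n - T),
      mul_nonneg (sq_nonneg ((1 / 2 : ℝ) ^ n - T)) (by positivity : (0 : ℝ) ≤ 2 ^ n)]
  refine hle.trans ?_
  gcongr
  calc 2 ^ n * T ^ 2 ≤ 2 ^ n * ((4 * Real.exp 1 * x ^ 2) ^ n / n.factorial) := by gcongr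
    _ = (8 * Real.exp 1 * x ^ 2) ^ n / n.factorial := by
      rw [← mul_div_assoc, ← mul_pow]; ring_nf

/-! ### Tensor product rules, and the reduction of the determinant error to one variable. -/

namespace QuadratureRule

variable {a b : ℝ}

/-- The tensor product rule `Q^n(F)` on `[a, b]^n`. -/
def applyPi (Q : QuadratureRule a b) (n : ℕ) (F : (Fin n → ℝ) → ℂ) : ℂ :=
  ∑ x : Fin n → Fin Q.m, (∏ p, (Q.w (x p) : ℂ)) * F (fun p => Q.x (x p))

theorem applyPi_succ (Q : QuadratureRule a b) (n : ℕ) (F : (Fin (n + 1) → ℝ) → ℂ) :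
    Q.applyPi (n + 1) F
      = Q.apply (fun s => Q.applyPi n (fun t => F (Fin.cons s t))) := by
  unfold applyPi apply
  rw [← (Fin.consEquiv (fun _ : Fin (n + 1) => Fin Q.m)).sum_comp, Fintype.sum_prod_type]
  refine Finset.sum_congr rfl fun i _ => ?_
  rw [Finset.mul_sum]
  refine Finset.sum_congr rfl fun x _ => ?_
  rw [Fin.prod_univ_succ]
  simp only [Fin.consEquiv_apply, Fin.cons_zero, Fin.cons_succ, mul_assoc]
  congr 3
  ext p
  refine Fin.cases ?_ (fun p => ?_) p <;> simp

theorem HasOrder.sum_weights {Q : QuadratureRule a b} {ν : ℕ} (h : Q.HasOrder ν) :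
    ∑ j, Q.w j = b - a := by
  simpa using h.2 1 (by simp)

theorem norm_apply_le {Q : QuadratureRule a b} (hpos : Q.PositiveWeights)
    (hsum : ∑ j, Q.w j = b - a) {f : ℝ → ℂ} {C : ℝ} (h : ∀ x ∈ Set.Icc a b, ‖f x‖ ≤ C) :
    ‖Q.apply f‖ ≤ (b - a) * C := by
  rw [← hsum, Finset.sum_mul]
  refine (norm_sum_le _ _).trans (Finset.sum_le_sum fun j _ => ?_)
  rw [norm_mul, Complex.norm_real, Real.norm_of_nonneg (hpos j).le]
  exact mul_le_mul_of_nonneg_left (h _ (Q.x_mem j)) (hpos j).le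

theorem apply_sub (Q : QuadratureRule a b) (f g : ℝ → ℂ) :
    Q.apply f - Q.apply g = Q.apply (fun x => f x - g x) := by
  simp only [apply, ← Finset.sum_sub_distrib, mul_sub]

end QuadratureRule

/-- Fubini's theorem on the cube `[a, b]^{n+1}`. -/
theorem integral_cube_succ {a b : ℝ} {n : ℕ} {F : (Fin (n + 1) → ℝ) → ℂ} (hF : Continuous F) :
    ∫ t in Set.univ.pi (fun _ : Fin (n + 1) => Set.Icc a b), F t
      = ∫ t in Set.univ.pi (fun _ : Fin n => Set.Icc a b), ∫ s in Set.Icc a b,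
          F (Fin.cons s t) := by
  have hmp := volume_preserving_piFinSuccAbove (fun _ : Fin (n + 1) => ℝ) 0
  have hset : (Set.univ.pi fun _ : Fin (n + 1) => Set.Icc a b)
      = (MeasurableEquiv.piFinSuccAbove (fun _ : Fin (n + 1) => ℝ) 0) ⁻¹'
        (Set.Icc a b ×ˢ Set.univ.pi fun _ : Fin n => Set.Icc a b) := by
    ext t
    simp only [Set.mem_pi, Set.mem_univ, true_imp_iff, Set.mem_preimage, Set.mem_prod]
    rw [Fin.forall_fin_succ]
    rfl
  have hF' : ∀ t, F t = (fun p : ℝ × (Fin n → ℝ) => F (Fin.cons p.1 p.2))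
      (MeasurableEquiv.piFinSuccAbove (fun _ : Fin (n + 1) => ℝ) 0 t) := fun t =>
    congrArg F (Fin.cons_self_tail t).symm
  have hcont : Continuous fun p : ℝ × (Fin n → ℝ) =>
      F (Fin.cons (α := fun _ => ℝ) p.1 p.2) := by fun_prop
  have hint : IntegrableOn (fun p : ℝ × (Fin n → ℝ) => F (Fin.cons (α := fun _ => ℝ) p.1 p.2))
      (Set.Icc a b ×ˢ Set.univ.pi fun _ : Fin n => Set.Icc a b) (volume.prod volume) :=
    hcont.continuousOn.integrableOn_compact
      (isCompact_Icc.prod (isCompact_univ_pi fun _ => isCompact_Icc))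
  rw [integral_congr_ae (Filter.Eventually.of_forall hF'), hset]
  refine (hmp.setIntegral_preimage_emb (MeasurableEquiv.measurableEmbedding _)
    (fun p : ℝ × (Fin n → ℝ) => F (Fin.cons (α := fun _ => ℝ) p.1 p.2)) _).trans ?_
  rw [Measure.volume_eq_prod, ← setIntegral_prod_swap, setIntegral_prod]
  · rfl
  · exact hint.swap

/-- The error of the tensor product rule is controlled by the error of the rule in each
variable. -/
theorem norm_applyPi_sub_integral_le {a b : ℝ} (hab : a ≤ b) {Q : QuadratureRule a b}
    (hpos : Q.PositiveWeights) (hsum : ∑ j, Q.w j = b - a) {ε : ℝ} (n : ℕ)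
    (F : (Fin n → ℝ) → ℂ) (hF : Continuous F)
    (h : ∀ j, ∀ t ∈ Set.univ.pi (fun _ : Fin n => Set.Icc a b),
      ‖Q.apply (fun s => F (Function.update t j s)) - ∫ s in a..b, F (Function.update t j s)‖
        ≤ (b - a) * ε) :
    ‖Q.applyPi n F - ∫ t in Set.univ.pi (fun _ : Fin n => Set.Icc a b), F t‖
      ≤ n * (b - a) ^ n * ε := by
  induction n with
  | zero =>
    have : (volume : Measure (Fin 0 → ℝ)) = Measure.dirac default := by
      rw [volume_pi, Measure.pi_of_empty _ default]
    have hF0 : F = fun _ => F default := by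
      ext t; rw [Subsingleton.elim t default]
    have hu : Set.univ.pi (fun _ : Fin 0 => Set.Icc a b) = Set.univ :=
      Set.eq_univ_of_forall fun t i => i.elim0
    rw [hF0, hu, Measure.restrict_univ, this]
    simp [QuadratureRule.applyPi]
  | succ n ih =>
    have hcont : Continuous fun p : ℝ × (Fin n → ℝ) =>
      F (Fin.cons (α := fun _ => ℝ) p.1 p.2) := by fun_prop
    rw [Q.applyPi_succ]
    set cube := Set.univ.pi (fun _ : Fin n => Set.Icc a b)
    have hcube : IsCompact cube := isCompact_univ_pi fun _ => isCompact_Icc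
    set G : ℝ → ℂ := fun s => ∫ t in cube, F (Fin.cons (α := fun _ => ℝ) s t)
    -- The last `n` variables, by induction for each node in the first variable; summing over the
    -- nodes costs the total weight `b - a`.
    have h1 : ‖Q.apply (fun s => Q.applyPi n (fun t => F (Fin.cons s t))) - Q.apply G‖
        ≤ (b - a) * (n * (b - a) ^ n * ε) := by
      rw [Q.apply_sub]
      refine QuadratureRule.norm_apply_le hpos hsum fun s hs => ?_
      refine ih (fun t => F (Fin.cons s t)) (by fun_prop) fun j t ht => ?_
      have := h j.succ (Fin.cons s t) (by
        intro i _
        refine Fin.cases hs (fun i => ?_) i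
        simpa using ht i trivial)
      simpa only [← Fin.cons_update] using this
    -- By Fubini, what is left is the one-dimensional error in the first variable, integrated over
    -- the others.
    have h2 : Q.apply G - ∫ t in Set.univ.pi (fun _ : Fin (n + 1) => Set.Icc a b), F t
        = ∫ t in cube, (Q.apply (fun s => F (Fin.cons s t))
          - ∫ s in a..b, F (Fin.cons s t)) := by
      rw [integral_cube_succ hF, integral_sub]
      · congr 1
        · simp only [QuadratureRule.apply, G]
          rw [integral_finsetSum]
          · exact Finset.sum_congr rfl fun i _ => (integral_const_mul _ _).symm
          · intro i _
            refine ContinuousOn.integrableOn_compact hcube (Continuous.continuousOn ?_)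
            fun_prop
        · simp_rw [intervalIntegral.integral_of_le hab, integral_Icc_eq_integral_Ioc]
          rfl
      · refine ContinuousOn.integrableOn_compact hcube (Continuous.continuousOn ?_)
        unfold QuadratureRule.apply
        fun_prop
      · refine ContinuousOn.integrableOn_compact hcube (Continuous.continuousOn ?_)
        apply intervalIntegral.continuous_parametric_intervalIntegral_of_continuous'
        exact hcont.comp continuous_swap
    have h3 : ‖Q.apply G - ∫ t in Set.univ.pi (fun _ : Fin (n + 1) => Set.Icc a b), F t‖
        ≤ ((b - a) * ε) * (b - a) ^ n := by
      rw [h2]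
      have hvol : volume.real cube = (b - a) ^ n := by
        rw [Measure.real, volume_pi_pi]
        simp [hab]
      rw [← hvol]
      refine norm_setIntegral_le_of_norm_le_const hcube.measure_lt_top fun t ht => ?_
      have := h 0 (Fin.cons a t) (by
        intro i _
        refine Fin.cases ⟨le_rfl, hab⟩ (fun i => ?_) i
        simpa using ht i trivial)
      simpa only [Fin.update_cons_zero] using this
    calc _ ≤ _ := norm_sub_le_norm_sub_add_norm_sub _ (Q.apply G) _
      _ ≤ (b - a) * (n * (b - a) ^ n * ε) + ((b - a) * ε) * (b - a) ^ n := add_le_add h1 h3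
      _ = _ := by push_cast; ring

theorem continuous_kernelDet {K : ℝ × ℝ → ℂ} (hK : Continuous K) (n : ℕ) :
    Continuous (kernelDet K n) := by
  unfold kernelDet
  refine Continuous.matrix_det ?_
  refine continuous_matrix fun p q => ?_
  simp only [Matrix.of_apply]
  fun_prop

/-- Von Koch's formula for the matrix `w_i K(x_i, x_j)`: the weights factor out of the rows of each
minor and form the weights of the tensor product rule. -/
theorem QuadratureRule.hasSum_nystromDet {a b : ℝ} (Q : QuadratureRule a b) (K : ℝ × ℝ → ℂ)
    (z : ℂ) :
    HasSum (fun n : ℕ => z ^ n / (n.factorial : ℂ) * Q.applyPi n (kernelDet K n))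
      (Q.nystromDet K z) := by
  convert hasSum_det_one_add_smul
    (Matrix.of fun i j : Fin Q.m => (Q.w i : ℂ) * K (Q.x i, Q.x j)) z using 1
  · ext n
    congr 1
    unfold QuadratureRule.applyPi kernelDet
    refine Finset.sum_congr rfl fun x _ => ?_
    exact (Matrix.det_mul_column (fun p => (Q.w (x p) : ℂ))
      (Matrix.of fun p q : Fin n => K (Q.x (x p), Q.x (x q)))).symm
  · unfold QuadratureRule.nystromDet
    congr 1
    ext i j
    simp [Matrix.one_apply, mul_assoc]

theorem natCast_mul_rpow_half {n : ℕ} (hn : 1 ≤ n) :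
    (n : ℝ) ^ (((n : ℝ) + 2) / 2) = n * (n : ℝ) ^ ((n : ℝ) / 2) := by
  have hn' : (0 : ℝ) < n := by exact_mod_cast hn
  rw [add_div, div_self two_ne_zero, Real.rpow_add hn', Real.rpow_one, mul_comm]

/-- Global continuity of `K` settles measurability and parametric integrals at once; the general
case reduces to it by clamping. Hadamard's bound and `Φ` also supply the convergence of the Fredholm
series. -/
theorem norm_nystromDet_sub_fredholmDet_le_of_continuous {a b : ℝ} (hab : a < b)
    {Q : QuadratureRule a b} (hpos : Q.PositiveWeights) (hsum : ∑ j, Q.w j = b - a)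
    {K : ℝ × ℝ → ℂ} (hK : Continuous K) {N δ : ℝ}
    (hN : ∀ p ∈ Set.Icc a b ×ˢ Set.Icc a b, ‖K p‖ ≤ N)
    (h : ∀ (n : ℕ) (j : Fin n), ∀ t ∈ Set.univ.pi (fun _ : Fin n => Set.Icc a b),
      ‖Q.apply (fun s => kernelDet K n (Function.update t j s))
          - ∫ s in a..b, kernelDet K n (Function.update t j s)‖
        ≤ (b - a) * (δ * ((n : ℝ) ^ ((n : ℝ) / 2) * N ^ n))) (z : ℂ) :
    ‖Q.nystromDet K z - fredholmDet a b K z‖ ≤ δ * Phi (‖z‖ * (b - a) * N) := by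
  have hN0 : 0 ≤ N := (norm_nonneg _).trans (hN (a, a) (by simp [hab.le]))
  have hba : 0 < b - a := sub_pos.2 hab
  set x := ‖z‖ * (b - a) * N with hx
  have hx0 : 0 ≤ x := by positivity
  set cube : (n : ℕ) → Set (Fin n → ℝ) := fun n => Set.univ.pi (fun _ => Set.Icc a b)
  have hcube : ∀ n, IsCompact (cube n) := fun n => isCompact_univ_pi fun _ => isCompact_Icc
  have hvol : ∀ n, volume.real (cube n) = (b - a) ^ n := fun n => by
    rw [Measure.real, volume_pi_pi]
    simp [hab.le]
  have hPhi := (summable_nat_add_iff 1).2 (summable_Phi hx0)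
  set φ : ℕ → ℝ := fun n => ((n : ℕ) : ℝ) ^ ((((n : ℕ) : ℝ) + 2) / 2) / (n.factorial : ℝ) * x ^ n
  have hφ : ∀ n : ℕ, 1 ≤ n → φ n = ‖z ^ n / (n.factorial : ℂ)‖ *
      (n * (b - a) ^ n * ((n : ℝ) ^ ((n : ℝ) / 2) * N ^ n)) := by
    intro n hn
    simp only [φ, hx, natCast_mul_rpow_half hn, norm_div, norm_pow, Complex.norm_natCast, mul_pow]
    ring
  have hdet : ∀ n, ‖∫ t in cube n, kernelDet K n t‖
      ≤ (b - a) ^ n * ((n : ℝ) ^ ((n : ℝ) / 2) * N ^ n) := by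
    intro n
    rw [← hvol n, mul_comm]
    refine norm_setIntegral_le_of_norm_le_const (hcube n).measure_lt_top fun t ht => ?_
    exact norm_det_le_pow _ _ fun p q => hN _ ⟨ht p trivial, ht q trivial⟩
  have hfs : Summable fun n : ℕ => z ^ (n + 1) / ((n + 1).factorial : ℂ) *
      ∫ t in cube (n + 1), kernelDet K (n + 1) t := by
    refine Summable.of_norm_bounded hPhi fun n => ?_
    change _ ≤ φ (n + 1)
    rw [norm_mul, hφ _ (Nat.le_add_left 1 n)]
    refine mul_le_mul_of_nonneg_left ((hdet _).trans ?_) (norm_nonneg _)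
    rw [mul_assoc]
    refine le_mul_of_one_le_left (by positivity) ?_
    exact_mod_cast Nat.le_add_left 1 n
  have hQs := (hasSum_nat_add_iff' 1).2 (Q.hasSum_nystromDet K z)
  have hQ0 : ∑ i ∈ Finset.range 1, z ^ i / (i.factorial : ℂ) * Q.applyPi i (kernelDet K i) = 1 := by
    simp [QuadratureRule.applyPi, kernelDet]
  rw [hQ0] at hQs
  have hdiff := hQs.sub hfs.hasSum
  have heq : Q.nystromDet K z - fredholmDet a b K z = Q.nystromDet K z - 1 -
      ∑' n : ℕ, z ^ (n + 1) / ((n + 1).factorial : ℂ) *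
        ∫ t in cube (n + 1), kernelDet K (n + 1) t := by
    rw [sub_sub]
    rfl
  rw [heq, ← hdiff.tsum_eq]
  refine tsum_of_norm_bounded (hPhi.hasSum.mul_left δ) fun n => ?_
  change _ ≤ δ * φ (n + 1)
  rw [← mul_sub, norm_mul, hφ _ (Nat.le_add_left 1 n)]
  have := norm_applyPi_sub_integral_le hab.le hpos hsum (n + 1) (kernelDet K (n + 1))
    (continuous_kernelDet hK _) (h (n + 1))
  calc _ ≤ _ := mul_le_mul_of_nonneg_left this (norm_nonneg _)
    _ = _ := by ring

/-- If the rule integrates the determinants `K_n` in each variable with error at most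
`(b - a) δ n^{n/2} N^n`, then the determinants differ by at most `δ Φ(|z| (b - a) N)`. -/
theorem norm_nystromDet_sub_fredholmDet_le {a b : ℝ} (hab : a < b)
    {Q : QuadratureRule a b} (hpos : Q.PositiveWeights) (hsum : ∑ j, Q.w j = b - a)
    {K : ℝ × ℝ → ℂ} (hK : ContinuousOn K (Set.Icc a b ×ˢ Set.Icc a b)) {N δ : ℝ}
    (hN : ∀ p ∈ Set.Icc a b ×ˢ Set.Icc a b, ‖K p‖ ≤ N)
    (h : ∀ (n : ℕ) (j : Fin n), ∀ t ∈ Set.univ.pi (fun _ : Fin n => Set.Ioo a b),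
      ‖Q.apply (fun s => kernelDet K n (Function.update t j s))
          - ∫ s in a..b, kernelDet K n (Function.update t j s)‖
        ≤ (b - a) * (δ * ((n : ℝ) ^ ((n : ℝ) / 2) * N ^ n))) (z : ℂ) :
    ‖Q.nystromDet K z - fredholmDet a b K z‖ ≤ δ * Phi (‖z‖ * (b - a) * N) := by
  -- Clamping both arguments to `[a, b]` extends `K` continuously to the plane; neither determinant
  -- sees the difference.
  set K' : ℝ × ℝ → ℂ := fun p =>
    K (Set.projIcc a b hab.le p.1, Set.projIcc a b hab.le p.2)
  have hK' : Continuous K' := by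
    refine hK.comp_continuous (by fun_prop) fun p => ⟨Subtype.coe_prop _, Subtype.coe_prop _⟩
  have hproj : ∀ s ∈ Set.Icc a b, ((Set.projIcc a b hab.le s : Set.Icc a b) : ℝ) = s :=
    fun s hs => by rw [Set.projIcc_of_mem _ hs]
  have hKK : ∀ p ∈ Set.Icc a b ×ˢ Set.Icc a b, K' p = K p := fun p hp => by
    simp only [K', hproj _ hp.1, hproj _ hp.2]
  have hdet : ∀ n, ∀ t ∈ Set.univ.pi (fun _ : Fin n => Set.Icc a b),
      kernelDet K' n t = kernelDet K n t := fun n t ht => by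
    unfold kernelDet
    congr 1
    ext p q
    exact hKK _ ⟨ht p trivial, ht q trivial⟩
  have e1 : Q.nystromDet K z = Q.nystromDet K' z := by
    unfold QuadratureRule.nystromDet
    congr 1
    ext i j
    simp only [Matrix.of_apply, hKK (Q.x i, Q.x j) ⟨Q.x_mem i, Q.x_mem j⟩]
  have e2 : fredholmDet a b K z = fredholmDet a b K' z := by
    unfold fredholmDet
    congr 2
    ext n
    congr 1
    exact setIntegral_congr_fun (MeasurableSet.univ_pi fun _ => measurableSet_Icc)
      fun t ht => (hdet _ t ht).symm
  rw [e1, e2]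
  refine norm_nystromDet_sub_fredholmDet_le_of_continuous hab hpos hsum hK'
    (fun p hp => by rw [hKK p hp]; exact hN p hp) (fun n j t ht => ?_) z
  -- The hypothesis concerns only the open cube, where derivatives of the kernel are available. The
  -- error is continuous in `t`, so the bound passes to the closure.
  have hclosed : IsClosed {t : Fin n → ℝ |
      ‖Q.apply (fun s => kernelDet K' n (Function.update t j s))
          - ∫ s in a..b, kernelDet K' n (Function.update t j s)‖
        ≤ (b - a) * (δ * ((n : ℝ) ^ ((n : ℝ) / 2) * N ^ n))} := by
    have hc := continuous_kernelDet hK' n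
    refine isClosed_le (Continuous.norm (Continuous.sub ?_ ?_)) continuous_const
    · unfold QuadratureRule.apply
      fun_prop
    · apply intervalIntegral.continuous_parametric_intervalIntegral_of_continuous'
      exact hc.comp (continuous_fst.update j continuous_snd)
  have hcl : closure (Set.univ.pi fun _ : Fin n => Set.Ioo a b)
      = Set.univ.pi fun _ => Set.Icc a b := by
    rw [closure_pi_set]
    simp_rw [closure_Ioo hab.ne]
  rw [← hcl] at ht
  refine closure_minimal (fun t ht => ?_) hclosed ht
  have hup : ∀ s ∈ Set.Icc a b,
      Function.update t j s ∈ Set.univ.pi (fun _ : Fin n => Set.Icc a b) := by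
    intro s hs i _
    rcases eq_or_ne i j with rfl | hij
    · simpa using hs
    · simpa [hij] using Set.Ioo_subset_Icc_self (ht i trivial)
  have f1 : Q.apply (fun s => kernelDet K' n (Function.update t j s))
      = Q.apply (fun s => kernelDet K n (Function.update t j s)) := by
    unfold QuadratureRule.apply
    exact Finset.sum_congr rfl fun i _ => congrArg _ (hdet _ _ (hup _ (Q.x_mem i)))
  have f2 : ∫ s in a..b, kernelDet K' n (Function.update t j s)
      = ∫ s in a..b, kernelDet K n (Function.update t j s) :=
    intervalIntegral.integral_congr fun s hs =>
      hdet _ _ (hup _ (by rwa [Set.uIcc_of_le hab.le] at hs))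
  have := h n j t ht
  rwa [← f1, ← f2] at this

/-! ### Quadrature error and polynomial approximation -/

/-- `HasOrder` speaks of real polynomials; exactness on monomials and linearity carry it to complex
coefficients. -/
theorem QuadratureRule.HasOrder.apply_polynomial {a b : ℝ} {Q : QuadratureRule a b} {ν : ℕ}
    (h : Q.HasOrder ν) (p : Polynomial ℂ) (hp : p.natDegree ≤ ν - 1) :
    Q.apply (fun x => p.eval (x : ℂ)) = ∫ t in a..b, p.eval (t : ℂ) := by
  have hX : ∀ i ≤ ν - 1, ∑ j, (Q.w j : ℂ) * (Q.x j : ℂ) ^ i = ∫ t in a..b, (t : ℂ) ^ i := by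
    intro i hi
    have := h.2 (Polynomial.X ^ i) (by simpa using hi)
    simp only [Polynomial.eval_pow, Polynomial.eval_X] at this
    have h2 := congrArg (fun r : ℝ => (r : ℂ)) this
    simp only [← intervalIntegral.integral_ofReal] at h2
    push_cast at h2
    exact h2
  unfold QuadratureRule.apply
  simp only [Polynomial.eval_eq_sum_range, Finset.mul_sum]
  rw [Finset.sum_comm, intervalIntegral.integral_finsetSum]
  · refine Finset.sum_congr rfl fun i hi => ?_
    rw [intervalIntegral.integral_const_mul, ← hX i (by
      have := Finset.mem_range.1 hi; omega), Finset.mul_sum]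
    exact Finset.sum_congr rfl fun j _ => by ring
  · intro i _
    exact Continuous.intervalIntegrable (by fun_prop) _ _

/-- The rule is exact on `p`, so only `Q (f - p)` and `∫ (f - p)` remain. Each is at most `(b - a)
e`, the first because the weights are positive with sum `b - a`. -/
theorem norm_apply_sub_integral_le_of_approx {a b : ℝ} (hab : a ≤ b) {Q : QuadratureRule a b}
    (hpos : Q.PositiveWeights) {ν : ℕ} (hν : Q.HasOrder ν) {f : ℝ → ℂ}
    (hf : ContinuousOn f (Set.Icc a b)) {p : Polynomial ℂ} (hp : p.natDegree ≤ ν - 1) {e : ℝ}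
    (h : ∀ x ∈ Set.Icc a b, ‖f x - p.eval (x : ℂ)‖ ≤ e) :
    ‖Q.apply f - ∫ t in a..b, f t‖ ≤ (b - a) * (2 * e) := by
  have h1 : ‖Q.apply f - Q.apply (fun x => p.eval (x : ℂ))‖ ≤ (b - a) * e := by
    rw [Q.apply_sub]
    exact QuadratureRule.norm_apply_le hpos hν.sum_weights h
  have h2 : ‖(∫ t in a..b, f t) - ∫ t in a..b, p.eval (t : ℂ)‖ ≤ (b - a) * e := by
    rw [← intervalIntegral.integral_sub]
    · refine (intervalIntegral.norm_integral_le_of_norm_le_const fun x hx => h x ?_).trans ?_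
      · rw [Set.uIoc_of_le hab] at hx
        exact Set.Ioc_subset_Icc_self hx
      · rw [abs_of_nonneg (sub_nonneg.2 hab), mul_comm]
    · exact ContinuousOn.intervalIntegrable (by rwa [Set.uIcc_of_le hab])
    · exact Continuous.intervalIntegrable (by fun_prop) _ _
  rw [hν.apply_polynomial p hp] at h1
  rw [norm_sub_rev] at h2
  calc _ ≤ _ := norm_sub_le_norm_sub_add_norm_sub _ (∫ t in a..b, p.eval (t : ℂ)) _
    _ ≤ (b - a) * e + (b - a) * e := add_le_add h1 h2
    _ = _ := by ring

/-! ### Jackson's theorem -/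

/-- The kernel `|∑_k α_k e^{iku}|²` with `α_k = sin ((k + 1) π / (n + 2))`, whose first Fourier
coefficient is as large as possible among nonnegative trigonometric polynomials of degree `n`. -/
noncomputable def jacksonKernel (n : ℕ) (u : ℝ) : ℝ :=
  ∑ j ∈ Finset.range (n + 1), ∑ k ∈ Finset.range (n + 1),
    Real.sin ((j + 1) * (Real.pi / (n + 2))) * Real.sin ((k + 1) * (Real.pi / (n + 2))) *
      Real.cos (((j - k : ℤ) : ℝ) * u)

theorem continuous_jacksonKernel (n : ℕ) : Continuous (jacksonKernel n) := by
  unfold jacksonKernel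
  fun_prop

theorem jacksonKernel_nonneg (n : ℕ) (u : ℝ) : 0 ≤ jacksonKernel n u := by
  set α : ℕ → ℝ := fun j => Real.sin ((j + 1) * (Real.pi / (n + 2)))
  have : jacksonKernel n u = (∑ j ∈ Finset.range (n + 1), α j * Real.cos (j * u)) ^ 2
      + (∑ j ∈ Finset.range (n + 1), α j * Real.sin (j * u)) ^ 2 := by
    rw [sq, sq, Finset.sum_mul_sum, Finset.sum_mul_sum, ← Finset.sum_add_distrib]
    unfold jacksonKernel
    refine Finset.sum_congr rfl fun j _ => ?_
    rw [← Finset.sum_add_distrib]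
    refine Finset.sum_congr rfl fun k _ => ?_
    push_cast
    rw [sub_mul, Real.cos_sub]
    simp only [α]
    ring
  rw [this]
  positivity

theorem jacksonKernel_periodic (n : ℕ) : Function.Periodic (jacksonKernel n) (2 * Real.pi) := by
  intro u
  unfold jacksonKernel
  refine Finset.sum_congr rfl fun j _ => Finset.sum_congr rfl fun k _ => ?_
  rw [mul_add, Real.cos_add_int_mul_two_pi]

theorem integral_cos_int_mul (m : ℤ) :
    ∫ u in (-Real.pi)..Real.pi, Real.cos (m * u) = if m = 0 then 2 * Real.pi else 0 := by
  split_ifs with h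
  · simp [h]; ring
  · have hm : (m : ℝ) ≠ 0 := by exact_mod_cast h
    rw [intervalIntegral.integral_comp_mul_left (fun u => Real.cos u) hm, integral_cos]
    simp [Real.sin_int_mul_pi]

/-- The mass of the kernel is `2π ∑ α_k²`. -/
theorem integral_jacksonKernel (n : ℕ) :
    ∫ u in (-Real.pi)..Real.pi, jacksonKernel n u = 2 * Real.pi *
      ∑ j ∈ Finset.range (n + 1), Real.sin ((j + 1) * (Real.pi / (n + 2))) ^ 2 := by
  unfold jacksonKernel
  rw [intervalIntegral.integral_finsetSum
    (fun j _ => Continuous.intervalIntegrable (by fun_prop) _ _), Finset.mul_sum]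
  refine Finset.sum_congr rfl fun j hj => ?_
  rw [intervalIntegral.integral_finsetSum
    (fun j _ => Continuous.intervalIntegrable (by fun_prop) _ _)]
  simp_rw [intervalIntegral.integral_const_mul, integral_cos_int_mul]
  rw [Finset.sum_eq_single j]
  · simp; ring
  · intro k _ hk
    rw [if_neg (by omega), mul_zero]
  · intro h; exact absurd hj h

/-- The vector `α` satisfies `α_{j-1} + α_{j+1} = 2 cos θ α_j` and vanishes at both ends `-1` and `n
+ 1`. Hence the sum of the `α_j α_{j+1}` is `cos θ` times the sum of the `α_j²`. -/
theorem integral_cos_mul_jacksonKernel (n : ℕ) :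
    ∫ u in (-Real.pi)..Real.pi, jacksonKernel n u * Real.cos u = 2 * Real.pi *
      (Real.cos (Real.pi / (n + 2)) *
        ∑ j ∈ Finset.range (n + 1), Real.sin ((j + 1) * (Real.pi / (n + 2))) ^ 2) := by
  set θ := Real.pi / (n + 2) with hθ
  set α : ℕ → ℝ := fun j => Real.sin ((j + 1) * θ) with hα
  have hn : ((n : ℝ) + 2) * θ = Real.pi := by rw [hθ]; field_simp
  have key : ∀ j k : ℕ, ∫ u in (-Real.pi)..Real.pi,
      Real.cos (((j - k : ℤ) : ℝ) * u) * Real.cos u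
        = (if j = k + 1 then Real.pi else 0) + (if k = j + 1 then Real.pi else 0) := by
    intro j k
    have h1 : ∀ u : ℝ, Real.cos (((j - k : ℤ) : ℝ) * u) * Real.cos u
        = (1 / 2) * Real.cos (((j - k - 1 : ℤ) : ℝ) * u)
          + (1 / 2) * Real.cos (((j - k + 1 : ℤ) : ℝ) * u) := by
      intro u
      push_cast
      rw [sub_mul _ 1, add_mul _ 1, one_mul, Real.cos_sub _ u, Real.cos_add _ u]
      ring
    simp_rw [h1]
    rw [intervalIntegral.integral_add (Continuous.intervalIntegrable (by fun_prop) _ _)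
      (Continuous.intervalIntegrable (by fun_prop) _ _)]
    simp_rw [intervalIntegral.integral_const_mul, integral_cos_int_mul]
    have e1 : ((j : ℤ) - k - 1 = 0) ↔ j = k + 1 := by omega
    have e2 : ((j : ℤ) - k + 1 = 0) ↔ k = j + 1 := by omega
    simp only [e1, e2]
    split_ifs <;> ring
  have hI : ∫ u in (-Real.pi)..Real.pi, jacksonKernel n u * Real.cos u
      = ∑ j ∈ Finset.range (n + 1), ∑ k ∈ Finset.range (n + 1), α j * α k *
        ((if j = k + 1 then Real.pi else 0) + (if k = j + 1 then Real.pi else 0)) := by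
    unfold jacksonKernel
    simp_rw [Finset.sum_mul]
    rw [intervalIntegral.integral_finsetSum
      (fun j _ => Continuous.intervalIntegrable (by fun_prop) _ _)]
    refine Finset.sum_congr rfl fun j _ => ?_
    rw [intervalIntegral.integral_finsetSum
      (fun j _ => Continuous.intervalIntegrable (by fun_prop) _ _)]
    refine Finset.sum_congr rfl fun k _ => ?_
    rw [← key, ← intervalIntegral.integral_const_mul]
    exact intervalIntegral.integral_congr fun u _ => mul_assoc (α j * α k) _ _
  have hsym : ∑ j ∈ Finset.range (n + 1), ∑ k ∈ Finset.range (n + 1), α j * α k *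
        ((if j = k + 1 then Real.pi else 0) + (if k = j + 1 then Real.pi else 0))
      = 2 * Real.pi * ∑ j ∈ Finset.range n, α j * α (j + 1) := by
    have h1 : ∑ j ∈ Finset.range (n + 1), ∑ k ∈ Finset.range (n + 1),
        α j * α k * (if k = j + 1 then Real.pi else 0)
          = Real.pi * ∑ j ∈ Finset.range n, α j * α (j + 1) := by
      rw [Finset.sum_range_succ, Finset.mul_sum, Finset.sum_eq_zero (s := Finset.range (n + 1)),
        add_zero]
      · refine Finset.sum_congr rfl fun j hj => ?_
        rw [Finset.sum_eq_single (j + 1)]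
        · simp; ring
        · intro k _ hk; simp [hk]
        · intro h
          simp only [Finset.mem_range] at hj h
          omega
      · intro k hk
        rw [if_neg (by have := Finset.mem_range.1 hk; omega), mul_zero]
    simp_rw [mul_add, Finset.sum_add_distrib]
    have h2 : ∑ j ∈ Finset.range (n + 1), ∑ k ∈ Finset.range (n + 1),
        α j * α k * (if j = k + 1 then Real.pi else 0)
          = Real.pi * ∑ j ∈ Finset.range n, α j * α (j + 1) := by
      rw [Finset.sum_comm, ← h1]
      exact Finset.sum_congr rfl fun j _ => Finset.sum_congr rfl fun k _ => by
        rw [mul_comm (α k)]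
    rw [h1, h2]
    ring
  have hrec : 2 * ∑ j ∈ Finset.range n, α j * α (j + 1)
      = 2 * (Real.cos θ * ∑ j ∈ Finset.range (n + 1), α j ^ 2) := by
    have h1 : ∀ j : ℕ, 2 * Real.cos θ * α (j + 1) = α (j + 2) + α j := by
      intro j
      simp only [hα]
      push_cast
      have e1 : ((j : ℝ) + 2 + 1) * θ = (j + 1 + 1) * θ + θ := by ring
      have e2 : ((j : ℝ) + 1) * θ = (j + 1 + 1) * θ - θ := by ring
      rw [e1, e2, Real.sin_add, Real.sin_sub]
      ring
    have h0 : 2 * Real.cos θ * α 0 = α 1 := by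
      simp only [hα]
      push_cast
      rw [show ((1 : ℝ) + 1) * θ = 2 * θ by ring, Real.sin_two_mul]
      simp; ring
    have hlast : α (n + 1) = 0 := by
      simp only [hα]
      push_cast
      rw [show ((n : ℝ) + 1 + 1) * θ = Real.pi by rw [← hn]; ring, Real.sin_pi]
    have h2 : ∀ m : ℕ, 2 * (Real.cos θ * ∑ j ∈ Finset.range (m + 1), α j ^ 2)
        = 2 * ∑ j ∈ Finset.range m, α j * α (j + 1) + α m * α (m + 1) := by
      intro m
      induction m with
      | zero =>
        simp only [zero_add, Finset.sum_range_one, Finset.sum_range_zero, ← h0]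
        ring
      | succ m ih =>
        rw [Finset.sum_range_succ (fun j => α j ^ 2) (m + 1),
          Finset.sum_range_succ (fun j => α j * α (j + 1)) m]
        linear_combination ih + α (m + 1) * h1 m
    rw [h2 n, hlast, mul_zero, add_zero]
  rw [hI, hsym]
  linear_combination Real.pi * hrec
/-- Jackson's theorem for functions of `cos θ`. -/
theorem exists_polynomial_approx_unit {g : ℝ → ℂ} {L : NNReal} (hg : LipschitzWith L g) (n : ℕ) :
    ∃ p : Polynomial ℂ, p.natDegree ≤ n ∧
      ∀ x ∈ Set.Icc (-1 : ℝ) 1, ‖g x - p.eval (x : ℂ)‖ ≤ L * (Real.pi / (n + 2)) := by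
  set θ := Real.pi / (n + 2) with hθ
  have hθ0 : 0 < θ := by positivity
  set α : ℕ → ℝ := fun j => Real.sin ((j + 1) * θ) with hα
  set A := ∑ j ∈ Finset.range (n + 1), α j ^ 2 with hA
  have hA0 : 0 < A := by
    refine Finset.sum_pos' (fun _ _ => sq_nonneg _) ⟨0, by simp, ?_⟩
    have : 0 < α 0 := by
      simp only [hα]
      refine Real.sin_pos_of_pos_of_lt_pi (by positivity) ?_
      rw [Nat.cast_zero, zero_add, one_mul, hθ, div_lt_iff₀ (by positivity)]
      nlinarith [Real.pi_pos, (Nat.cast_nonneg n : (0 : ℝ) ≤ n)]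
    positivity
  have hpi := Real.pi_pos
  have hgc : Continuous g := hg.continuous
  have hJc := continuous_jacksonKernel n
  set c : ℤ → ℂ := fun m => ∫ u in (-Real.pi)..Real.pi, g (Real.cos u) * Real.cos (m * u) with hc
  -- This is the convolution of `g ∘ cos` with the normalised kernel, expanded in cosines; its
  -- frequencies `j - k` have absolute value at most `n`.
  set p : Polynomial ℂ := ∑ j ∈ Finset.range (n + 1), ∑ k ∈ Finset.range (n + 1),
    Polynomial.C ((α j * α k : ℝ) / (2 * Real.pi * A : ℝ) * c (j - k)) *
      Polynomial.Chebyshev.T ℂ (j - k) with hp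
  refine ⟨p, ?_, fun x hx => ?_⟩
  · refine Polynomial.natDegree_sum_le_of_forall_le _ _ fun j hj => ?_
    refine Polynomial.natDegree_sum_le_of_forall_le _ _ fun k hk => ?_
    refine (Polynomial.natDegree_C_mul_le _ _).trans ?_
    rw [Polynomial.Chebyshev.natDegree_T]
    rw [Finset.mem_range] at hj hk
    omega
  obtain ⟨φ, rfl⟩ : ∃ φ, Real.cos φ = x := ⟨Real.arccos x, Real.cos_arccos hx.1 hx.2⟩
  -- Since `g ∘ cos` is even, its sine coefficients vanish, so the convolution is a polynomial in
  -- `cos φ`.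
  have hodd : ∀ m : ℤ, ∫ u in (-Real.pi)..Real.pi, g (Real.cos u) * Real.sin (m * u) = 0 := by
    intro m
    have h1 := intervalIntegral.integral_comp_neg (a := -Real.pi) (b := Real.pi)
      (fun u => g (Real.cos u) * (Real.sin (m * u) : ℂ))
    simp only [Real.cos_neg, mul_neg, Real.sin_neg, Complex.ofReal_neg, neg_neg,
      intervalIntegral.integral_neg] at h1
    exact self_eq_neg.1 h1.symm
  have hpval : (2 * Real.pi * A : ℝ) * p.eval ((Real.cos φ : ℝ) : ℂ)
      = ∫ u in (-Real.pi)..Real.pi, g (Real.cos (φ - u)) * jacksonKernel n u := by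
    have hshift : ∫ u in (-Real.pi)..Real.pi, g (Real.cos (φ - u)) * jacksonKernel n u
        = ∫ u in (-Real.pi)..Real.pi, g (Real.cos u) * jacksonKernel n (φ - u) := by
      have h1 := intervalIntegral.integral_comp_sub_left (a := -Real.pi) (b := Real.pi)
        (fun u => g (Real.cos u) * (jacksonKernel n (φ - u) : ℂ)) φ
      simp only [sub_sub_cancel] at h1
      rw [h1]
      have hper : Function.Periodic
          (fun u => g (Real.cos u) * (jacksonKernel n (φ - u) : ℂ)) (2 * Real.pi) := by
        intro u
        have h2 := (jacksonKernel_periodic n).sub_eq (φ - u)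
        simp only [Real.cos_add_two_pi, ← sub_sub, h2]
      have h3 := hper.intervalIntegral_add_eq (φ - Real.pi) (-Real.pi)
      rw [show φ - Real.pi + 2 * Real.pi = φ - -Real.pi by ring,
        show -Real.pi + 2 * Real.pi = Real.pi by ring] at h3
      exact h3
    rw [hshift]
    unfold jacksonKernel
    simp only [Complex.ofReal_sum, Finset.mul_sum]
    rw [intervalIntegral.integral_finsetSum
      (fun j _ => Continuous.intervalIntegrable (by fun_prop) _ _), hp, Polynomial.eval_finsetSum,
      Finset.mul_sum]
    refine Finset.sum_congr rfl fun j _ => ?_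
    rw [intervalIntegral.integral_finsetSum
      (fun j _ => Continuous.intervalIntegrable (by fun_prop) _ _), Polynomial.eval_finsetSum,
      Finset.mul_sum]
    refine Finset.sum_congr rfl fun k _ => ?_
    have h4 : ∀ u : ℝ, g (Real.cos u) *
        ((Real.sin ((j + 1) * (Real.pi / (n + 2))) * Real.sin ((k + 1) * (Real.pi / (n + 2))) *
          Real.cos (((j - k : ℤ) : ℝ) * (φ - u)) : ℝ) : ℂ)
        = ((α j * α k * Real.cos (((j - k : ℤ) : ℝ) * φ) : ℝ) : ℂ) *
            (g (Real.cos u) * Real.cos (((j - k : ℤ) : ℝ) * u))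
          + ((α j * α k * Real.sin (((j - k : ℤ) : ℝ) * φ) : ℝ) : ℂ) *
            (g (Real.cos u) * Real.sin (((j - k : ℤ) : ℝ) * u)) := by
      intro u
      simp only [hα]
      rw [mul_sub, Real.cos_sub]
      simp only [Complex.ofReal_mul, Complex.ofReal_add]
      ring
    simp_rw [h4]
    rw [intervalIntegral.integral_add (Continuous.intervalIntegrable (by fun_prop) _ _)
      (Continuous.intervalIntegrable (by fun_prop) _ _), intervalIntegral.integral_const_mul,
      intervalIntegral.integral_const_mul, hodd, mul_zero, add_zero, Polynomial.eval_mul,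
      Polynomial.eval_C, Complex.ofReal_cos φ, Polynomial.Chebyshev.T_complex_cos]
    have hne : ((2 * Real.pi * A : ℝ) : ℂ) ≠ 0 := by
      exact_mod_cast (by positivity : (2 * Real.pi * A) ≠ 0)
    simp only [hc]
    rw [Complex.ofReal_mul (α j * α k), Complex.ofReal_cos (_ * φ)]
    generalize ((2 * Real.pi * A : ℝ) : ℂ) = B at hne ⊢
    push_cast
    field_simp
  have hJ0 : ∫ u in (-Real.pi)..Real.pi, jacksonKernel n u = 2 * Real.pi * A :=
    integral_jacksonKernel n
  have hJ1 : ∫ u in (-Real.pi)..Real.pi, jacksonKernel n u * Real.cos u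
      = 2 * Real.pi * (Real.cos θ * A) := integral_cos_mul_jacksonKernel n
  have hdiff : (2 * Real.pi * A : ℝ) * (g (Real.cos φ) - p.eval ((Real.cos φ : ℝ) : ℂ))
      = ∫ u in (-Real.pi)..Real.pi,
        (g (Real.cos φ) - g (Real.cos (φ - u))) * jacksonKernel n u := by
    rw [mul_sub, hpval, ← hJ0, mul_comm, ← intervalIntegral.integral_ofReal,
      ← intervalIntegral.integral_const_mul, ← intervalIntegral.integral_sub
        (Continuous.intervalIntegrable (by fun_prop) _ _)
        (Continuous.intervalIntegrable (by fun_prop) _ _)]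
    simp only [sub_mul]
  have hpt : ∀ u : ℝ, ‖(g (Real.cos φ) - g (Real.cos (φ - u))) * (jacksonKernel n u : ℂ)‖
      ≤ L * ((1 / θ + θ / 2) * jacksonKernel n u
          - (1 / θ) * (jacksonKernel n u * Real.cos u)) := by
    intro u
    have h1 : ‖g (Real.cos φ) - g (Real.cos (φ - u))‖
        ≤ L * |Real.cos φ - Real.cos (φ - u)| := by
      simpa [dist_eq_norm] using hg.dist_le_mul (Real.cos φ) (Real.cos (φ - u))
    -- The chord has squared length `2 (1 - cos u)`, and `d ≤ d² / (2θ) + θ / 2`. The bound involves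
    -- `u` only through `cos u`, so integrating it needs just the mass and first moment of the
    -- kernel; as `1 - cos θ ≤ θ² / 2`, the mean is at most `θ`.
    have h2 : |Real.cos φ - Real.cos (φ - u)| ≤ (1 - Real.cos u) / θ + θ / 2 := by
      set d := |Real.cos φ - Real.cos (φ - u)|
      have h3 : d ^ 2 ≤ 2 * (1 - Real.cos u) := by
        rw [sq_abs, Real.cos_sub]
        nlinarith [sq_nonneg (Real.sin φ * (1 - Real.cos u) + Real.cos φ * Real.sin u),
          Real.sin_sq_add_cos_sq u, Real.sin_sq_add_cos_sq φ]
      have h4 : (1 - Real.cos u) / θ + θ / 2 - d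
          = ((d - θ) ^ 2 + (2 * (1 - Real.cos u) - d ^ 2)) / (2 * θ) := by
        field_simp
        ring
      have h5 : 0 ≤ ((d - θ) ^ 2 + (2 * (1 - Real.cos u) - d ^ 2)) / (2 * θ) := by
        have := sub_nonneg.2 h3
        positivity
      linarith
    rw [norm_mul, Complex.norm_real, Real.norm_of_nonneg (jacksonKernel_nonneg n u)]
    calc _ ≤ (L * ((1 - Real.cos u) / θ + θ / 2)) * jacksonKernel n u :=
          mul_le_mul_of_nonneg_right (h1.trans (mul_le_mul_of_nonneg_left h2 L.coe_nonneg))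
            (jacksonKernel_nonneg n u)
      _ = _ := by ring
  have hint : ‖((2 * Real.pi * A : ℝ) : ℂ) * (g (Real.cos φ) - p.eval ((Real.cos φ : ℝ) : ℂ))‖
      ≤ L * ((1 / θ + θ / 2) * (2 * Real.pi * A)
          - (1 / θ) * (2 * Real.pi * (Real.cos θ * A))) := by
    rw [hdiff, ← hJ1, ← hJ0, ← intervalIntegral.integral_const_mul,
      ← intervalIntegral.integral_const_mul, ← intervalIntegral.integral_sub
        (Continuous.intervalIntegrable (by fun_prop) _ _)
        (Continuous.intervalIntegrable (by fun_prop) _ _), ← intervalIntegral.integral_const_mul]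
    exact intervalIntegral.norm_integral_le_of_norm_le (by linarith)
      (Filter.Eventually.of_forall fun u _ => hpt u)
      (Continuous.intervalIntegrable (by fun_prop) _ _)
  have hpA : 0 < 2 * Real.pi * A := by positivity
  rw [norm_mul, Complex.norm_real, Real.norm_of_nonneg hpA.le] at hint
  have hcos := Real.one_sub_sq_div_two_le_cos (x := θ)
  refine le_of_mul_le_mul_left (hint.trans ?_) hpA
  have h6 : (1 / θ + θ / 2) * (2 * Real.pi * A) - (1 / θ) * (2 * Real.pi * (Real.cos θ * A))
      ≤ 2 * Real.pi * A * θ := by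
    have h7 : (1 - Real.cos θ) / θ ≤ θ / 2 := by
      rw [div_le_iff₀ hθ0]; nlinarith
    calc _ = 2 * Real.pi * A * ((1 - Real.cos θ) / θ + θ / 2) := by ring
      _ ≤ 2 * Real.pi * A * (θ / 2 + θ / 2) := by gcongr
      _ = _ := by ring
  calc _ ≤ L * (2 * Real.pi * A * θ) := mul_le_mul_of_nonneg_left h6 L.coe_nonneg
    _ = _ := by ring

/-! ### Jackson's theorem on an interval, and the quadrature error it implies. -/

/-- `f` is `r` times differentiable on `(a, b)` and its `r`-th derivative is Lipschitz continuous
there with constant `N`. -/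
def DiffLip (a b : ℝ) : ℕ → ℝ → (ℝ → ℂ) → Prop
  | 0, N, f => ∀ x ∈ Set.Ioo a b, ∀ y ∈ Set.Ioo a b, ‖f x - f y‖ ≤ N * |x - y|
  | r + 1, N, f => ∃ f' : ℝ → ℂ, (∀ x ∈ Set.Ioo a b, HasDerivAt f (f' x) x) ∧ DiffLip a b r N f'

theorem DiffLip.add {a b : ℝ} {r : ℕ} {N₁ N₂ : ℝ} {f g : ℝ → ℂ} (hf : DiffLip a b r N₁ f)
    (hg : DiffLip a b r N₂ g) : DiffLip a b r (N₁ + N₂) (fun x => f x + g x) := by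
  induction r generalizing f g with
  | zero =>
    intro x hx y hy
    rw [add_sub_add_comm, add_mul]
    exact (norm_add_le _ _).trans (add_le_add (hf x hx y hy) (hg x hx y hy))
  | succ r ih =>
    obtain ⟨f', hf', hf''⟩ := hf
    obtain ⟨g', hg', hg''⟩ := hg
    exact ⟨fun x => f' x + g' x, fun x hx => (hf' x hx).add (hg' x hx), ih hf'' hg''⟩

/-- The constant in Jackson's theorem for complex valued Lipschitz functions. -/
noncomputable def jacksonConst : ℝ := lipschitzExtensionConstant ℂ * Real.pi / 2

theorem jacksonConst_pos : 0 < jacksonConst := by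
  have : (0 : ℝ) < lipschitzExtensionConstant ℂ := lipschitzExtensionConstant_pos ℂ
  have := Real.pi_pos
  unfold jacksonConst
  positivity

theorem natDegree_comp_affine_le (p : Polynomial ℂ) (u v : ℂ) :
    (p.comp (Polynomial.C u * Polynomial.X + Polynomial.C v)).natDegree ≤ p.natDegree := by
  refine Polynomial.natDegree_comp_le.trans ?_
  calc _ ≤ p.natDegree * 1 := Nat.mul_le_mul_left _ Polynomial.natDegree_linear_le
    _ = _ := mul_one _

theorem exists_polynomial_approx_of_lipschitz {a b : ℝ} (hab : a < b) {N : ℝ} (hN : 0 ≤ N)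
    {f : ℝ → ℂ} (hf : DiffLip a b 0 N f) (n : ℕ) :
    ∃ p : Polynomial ℂ, p.natDegree ≤ n ∧
      ∀ x ∈ Set.Ioo a b, ‖f x - p.eval (x : ℂ)‖ ≤ jacksonConst * (b - a) * N / (n + 1) := by
  lift N to NNReal using hN
  have hL : LipschitzOnWith N f (Set.Ioo a b) :=
    LipschitzOnWith.of_dist_le_mul fun x hx y hy => by
      rw [dist_eq_norm, Real.dist_eq]; exact hf x hx y hy
  -- The theorem on `[-1, 1]` needs a globally Lipschitz function; the extension accounts for the
  -- factor `lipschitzExtensionConstant ℂ` in `jacksonConst`.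
  obtain ⟨F, hF, hFf⟩ := hL.extend_finite_dimension
  have hba : 0 < b - a := sub_pos.2 hab
  set h : NNReal := ⟨(b - a) / 2, by positivity⟩ with hh
  have hh' : (h : ℝ) = (b - a) / 2 := rfl
  have hh0 : (h : ℝ) ≠ 0 := by rw [hh']; positivity
  set c := (a + b) / 2 with hc
  have haff : LipschitzWith h (fun y : ℝ => c + h * y) :=
    LipschitzWith.of_dist_le_mul fun x y => by
      rw [Real.dist_eq, Real.dist_eq, add_sub_add_left_eq_sub, ← mul_sub, abs_mul,
        abs_of_nonneg h.coe_nonneg]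
  obtain ⟨p, hp, happ⟩ := exists_polynomial_approx_unit (hF.comp haff) n
  refine ⟨p.comp (Polynomial.C ((h : ℝ) : ℂ)⁻¹ * Polynomial.X
    + Polynomial.C (-(c / h : ℝ) : ℂ)), (natDegree_comp_affine_le _ _ _).trans hp, fun x hx => ?_⟩
  have hy : (x - c) / h ∈ Set.Icc (-1 : ℝ) 1 := by
    rw [hh', hc, Set.mem_Icc, le_div_iff₀ (by positivity), div_le_iff₀ (by positivity)]
    constructor <;> linarith [hx.1, hx.2]
  have := happ _ hy
  have e1 : c + h * ((x - c) / h) = x := by field_simp; ring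
  have e2 : ((h : ℝ) : ℂ)⁻¹ * (x : ℂ) + (-(c / h : ℝ) : ℂ) = (((x - c) / h : ℝ) : ℂ) := by
    push_cast; ring
  simp only [Function.comp_apply, e1, ← hFf hx] at this
  simp only [Polynomial.eval_comp, Polynomial.eval_add, Polynomial.eval_mul, Polynomial.eval_C,
    Polynomial.eval_X, e2]
  refine this.trans ?_
  push_cast
  rw [hh', jacksonConst]
  calc _ ≤ lipschitzExtensionConstant ℂ * N * ((b - a) / 2) * (Real.pi / (n + 1)) := by
        gcongr
        norm_num
    _ = _ := by ring

theorem exists_polynomial_derivative_eq (q : Polynomial ℂ) {m : ℕ} (hq : q.natDegree ≤ m) :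
    ∃ P : Polynomial ℂ, P.natDegree ≤ m + 1 ∧ P.derivative = q := by
  refine ⟨∑ i ∈ Finset.range (m + 1), Polynomial.C (q.coeff i / (i + 1)) * Polynomial.X ^ (i + 1),
    ?_, ?_⟩
  · refine Polynomial.natDegree_sum_le_of_forall_le _ _ fun i hi => ?_
    refine (Polynomial.natDegree_C_mul_X_pow_le _ _).trans ?_
    have := Finset.mem_range.1 hi
    omega
  · rw [Polynomial.derivative_sum]
    conv_rhs => rw [q.as_sum_range' (m + 1) (Nat.lt_succ_of_le hq)]
    refine Finset.sum_congr rfl fun i _ => ?_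
    rw [Polynomial.derivative_C_mul_X_pow, ← Polynomial.C_mul_X_pow_eq_monomial]
    have : (i : ℂ) + 1 ≠ 0 := Nat.cast_add_one_ne_zero i
    push_cast
    rw [div_mul_cancel₀ _ this]

/-- Jackson's theorem for functions with a Lipschitz continuous `r`-th derivative. -/
theorem exists_polynomial_approx {a b : ℝ} (hab : a < b) {N : ℝ} (hN : 0 ≤ N) {r : ℕ}
    {f : ℝ → ℂ} (hf : DiffLip a b r N f) {n : ℕ} (hn : r ≤ n) :
    ∃ p : Polynomial ℂ, p.natDegree ≤ n ∧ ∀ x ∈ Set.Ioo a b, ‖f x - p.eval (x : ℂ)‖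
      ≤ (jacksonConst * (b - a)) ^ (r + 1) * N / (n + 1).descFactorial (r + 1) := by
  have hC := jacksonConst_pos
  have hba : 0 < b - a := sub_pos.2 hab
  induction r generalizing f n with
  | zero => simpa using exists_polynomial_approx_of_lipschitz hab hN hf n
  | succ r ih =>
    obtain ⟨f', hf', hr⟩ := hf
    obtain ⟨m, rfl⟩ : ∃ m, n = m + 1 := ⟨n - 1, by omega⟩
    obtain ⟨q, hq, hqa⟩ := ih hr (n := m) (by omega)
    obtain ⟨P, hP, rfl⟩ := exists_polynomial_derivative_eq q hq
    -- If `P' = q` approximates `f'` within `e`, then `f - P` is Lipschitz with constant `e`, and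
    -- approximating it gains a factor `C (b - a) / (n + 1)`. The degree drops by one at each level,
    -- hence the falling factorial.
    set e := (jacksonConst * (b - a)) ^ (r + 1) * N / (m + 1).descFactorial (r + 1) with he
    have he0 : 0 ≤ e := by positivity
    have hlip : DiffLip a b 0 e (fun x => f x - P.eval (x : ℂ)) := by
      intro x hx y hy
      have hd : ∀ t ∈ Set.Ioo a b, HasDerivWithinAt (fun x : ℝ => f x - P.eval (x : ℂ))
          (f' t - P.derivative.eval (t : ℂ)) (Set.Ioo a b) t := fun t ht =>
        ((hf' t ht).sub (P.hasDerivAt (t : ℂ)).comp_ofReal).hasDerivWithinAt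
      have := (convex_Ioo a b).norm_image_sub_le_of_norm_hasDerivWithin_le hd hqa hy hx
      simpa [Real.norm_eq_abs] using this
    obtain ⟨p, hp, hpa⟩ := exists_polynomial_approx_of_lipschitz hab he0 hlip (m + 1)
    refine ⟨P + p, (Polynomial.natDegree_add_le _ _).trans (max_le hP hp), fun x hx => ?_⟩
    rw [Polynomial.eval_add, ← sub_sub]
    refine (hpa x hx).trans (le_of_eq ?_)
    rw [Nat.succ_descFactorial_succ (m + 1), he]
    push_cast
    rw [pow_succ _ (r + 1)]
    field_simp

/-- The constant in the one-dimensional quadrature error estimate. -/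
noncomputable def quadratureConst (k : ℕ) : ℝ := 2 * (jacksonConst * k) ^ k

theorem norm_apply_sub_integral_le_of_diffLip {a b : ℝ} (hab : a < b) {Q : QuadratureRule a b}
    (hpos : Q.PositiveWeights) {ν : ℕ} (hν : Q.HasOrder ν) {k : ℕ} (hk : 1 ≤ k) (hkν : k ≤ ν)
    {f : ℝ → ℂ} (hc : ContinuousOn f (Set.Icc a b)) {N : ℝ} (hN : 0 ≤ N)
    (hf : DiffLip a b (k - 1) N f) :
    ‖Q.apply f - ∫ t in a..b, f t‖
      ≤ quadratureConst k * (b - a) ^ (k + 1) * ((ν : ℝ) ^ k)⁻¹ * N := by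
  have hC := jacksonConst_pos
  have hba : 0 < b - a := sub_pos.2 hab
  obtain ⟨p, hp, hpa⟩ := exists_polynomial_approx hab hN hf (n := ν - 1) (by omega)
  rw [Nat.sub_add_cancel hk, Nat.sub_add_cancel (hk.trans hkν)] at hpa
  set e := (jacksonConst * (b - a)) ^ k * N / ν.descFactorial k with he
  -- The nodes may be endpoints, so the bound is extended by continuity.
  have hpa' : ∀ x ∈ Set.Icc a b, ‖f x - p.eval (x : ℂ)‖ ≤ e := by
    rw [← closure_Ioo hab.ne] at hc ⊢
    intro x hx
    refine le_on_closure hpa (ContinuousOn.norm (hc.sub ?_)) continuousOn_const hx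
    exact Continuous.continuousOn (by fun_prop)
  refine (norm_apply_sub_integral_le_of_approx hab.le hpos hν hc hp hpa').trans ?_
  have hν0 : (0 : ℝ) < ν := by exact_mod_cast hk.trans hkν
  -- Each of the `k` factors is at least `ν - k + 1`, and `k (ν - k + 1) ≥ ν` for `1 ≤ k ≤ ν`. This
  -- is the source of `k^k` in `quadratureConst`.
  have hdesc : ((ν : ℝ) / k) ^ k ≤ ν.descFactorial k := by
    have hk0 : (0 : ℝ) < k := by exact_mod_cast hk
    have h1 : (ν : ℝ) / k ≤ ((ν + 1 - k : ℕ) : ℝ) := by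
      rw [div_le_iff₀ hk0, Nat.cast_sub (by omega)]
      push_cast
      have h2 : (1 : ℝ) ≤ k := by exact_mod_cast hk
      have h3 : (k : ℝ) ≤ ν := by exact_mod_cast hkν
      nlinarith
    calc _ ≤ ((ν + 1 - k : ℕ) : ℝ) ^ k := pow_le_pow_left₀ (by positivity) h1 k
      _ ≤ _ := by exact_mod_cast Nat.pow_sub_le_descFactorial ν k
  have hk0 : (0 : ℝ) < k := by exact_mod_cast hk
  have he' : e ≤ (jacksonConst * (b - a)) ^ k * N / ((ν : ℝ) / k) ^ k := by
    rw [he]; gcongr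
  calc (b - a) * (2 * e)
      ≤ (b - a) * (2 * ((jacksonConst * (b - a)) ^ k * N / ((ν : ℝ) / k) ^ k)) := by gcongr
    _ = _ := by
      rw [quadratureConst, mul_pow, mul_pow, div_pow, pow_succ]
      field_simp

/-! ### Sharp Lipschitz constants and `L^∞` norms -/

theorem linftyENorm_le {α : Type*} [MeasureSpace α] {f : α → ℂ} {S : Set α}
    (hS : MeasurableSet S) {C : ℝ} (h : ∀ x ∈ S, ‖f x‖ ≤ C) :
    linftyENorm f S ≤ ENNReal.ofReal C := by
  unfold linftyENorm
  rw [eLpNorm_exponent_top]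
  exact eLpNormEssSup_le_of_ae_bound ((ae_restrict_iff' hS).2 (Filter.Eventually.of_forall h))

theorem ae_norm_le_of_linftyENorm_le {α : Type*} [MeasureSpace α] {f : α → ℂ} {S : Set α}
    {C : ℝ} (hC : 0 ≤ C) (h : linftyENorm f S ≤ ENNReal.ofReal C) :
    ∀ᵐ x ∂volume.restrict S, ‖f x‖ ≤ C := by
  unfold linftyENorm at h
  rw [eLpNorm_exponent_top] at h
  filter_upwards [ae_le_eLpNormEssSup (f := f) (μ := volume.restrict S)] with x hx
  have := hx.trans h
  rw [← ofReal_norm] at this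
  exact (ENNReal.ofReal_le_ofReal_iff hC).1 this

/-- A Lipschitz function is Lipschitz with constant the essential supremum of its derivative. -/
theorem norm_sub_le_of_ae_norm_deriv_le {a b : ℝ} {g : ℝ → ℂ} {L : NNReal}
    (hg : LipschitzOnWith L g (Set.Ioo a b)) {N : ℝ}
    (hN : ∀ᵐ x ∂volume.restrict (Set.Ioo a b), ‖deriv g x‖ ≤ N) :
    ∀ x ∈ Set.Ioo a b, ∀ y ∈ Set.Ioo a b, ‖g x - g y‖ ≤ N * |x - y| := by
  intro x hx y hy
  -- A norming functional reduces to a real Lipschitz function, which is absolutely continuous and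
  -- so the integral of its derivative.
  obtain ⟨ℓ, hℓ, hℓg⟩ := exists_dual_vector'' ℝ (g x - g y)
  have hsub : Set.uIcc y x ⊆ Set.Ioo a b := (Set.ordConnected_Ioo).uIcc_subset hy hx
  have hlip : LipschitzOnWith (‖ℓ‖₊ * L) (fun t => ℓ (g t)) (Set.uIcc y x) :=
    ℓ.lipschitz.comp_lipschitzOnWith (hg.mono hsub)
  have hint := hlip.absolutelyContinuousOnInterval.integral_deriv_eq_sub
  have hℓg' : ℓ (g x) - ℓ (g y) = ‖g x - g y‖ := by
    rw [← map_sub, hℓg]; rfl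
  rw [hℓg'] at hint
  have hbound : ∀ᵐ t, t ∈ Set.uIoc y x → ‖deriv (fun t => ℓ (g t)) t‖ ≤ N := by
    rw [ae_restrict_iff' measurableSet_Ioo] at hN
    have hd := hg.ae_differentiableWithinAt_of_mem (μ := volume)
    filter_upwards [hN, hd] with t ht htd htm
    have htI : t ∈ Set.Ioo a b := hsub (Set.uIoc_subset_uIcc htm)
    have hdiff : DifferentiableAt ℝ g t := (htd htI).differentiableAt (Ioo_mem_nhds htI.1 htI.2)
    have : deriv (fun t => ℓ (g t)) t = ℓ (deriv g t) :=
      (ℓ.hasFDerivAt.comp_hasDerivAt t hdiff.hasDerivAt).deriv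
    rw [this]
    calc ‖ℓ (deriv g t)‖ ≤ ‖ℓ‖ * ‖deriv g t‖ := ℓ.le_opNorm _
      _ ≤ 1 * ‖deriv g t‖ := mul_le_mul_of_nonneg_right hℓ (norm_nonneg _)
      _ ≤ N := by rw [one_mul]; exact ht htI
  have := intervalIntegral.norm_integral_le_of_norm_le_const_ae hbound
  rwa [hint, norm_norm] at this

theorem diffLip_of_contDiffOn {a b : ℝ} {n : ℕ} {N : ℝ} {f : ℝ → ℂ}
    (hf : ContDiffOn ℝ n f (Set.Ioo a b))
    (h : ∀ x ∈ Set.Ioo a b, ∀ y ∈ Set.Ioo a b,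
      ‖iteratedDeriv n f x - iteratedDeriv n f y‖ ≤ N * |x - y|) : DiffLip a b n N f := by
  induction n generalizing f with
  | zero => simpa [DiffLip] using h
  | succ n ih =>
    push_cast at hf
    rw [contDiffOn_succ_iff_deriv_of_isOpen isOpen_Ioo] at hf
    refine ⟨deriv f, fun x hx => ?_, ih hf.2.2 (by simpa only [iteratedDeriv_succ'] using h)⟩
    exact (hf.1.differentiableAt (Ioo_mem_nhds hx.1 hx.2)).hasDerivAt

theorem ContDiffLip.exists_lipschitzOnWith {E : Type*} [NormedAddCommGroup E] [NormedSpace ℝ E]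
    {n : ℕ} {f : E → ℂ} {S U : Set E} (hf : ContDiffLip n f S) (hS : UniqueDiffOn ℝ S)
    (hU : IsOpen U) (hUS : U ⊆ S) :
    ∃ L : NNReal, LipschitzOnWith L (iteratedFDeriv ℝ n f) U := by
  obtain ⟨hc, L, hL⟩ := hf
  have heq : ∀ x ∈ U, iteratedFDerivWithin ℝ n f S x = iteratedFDeriv ℝ n f x := fun x hx =>
    iteratedFDerivWithin_eq_iteratedFDeriv hS
      (hc.contDiffAt (Filter.mem_of_superset (hU.mem_nhds hx) hUS)) (hUS hx)
  refine ⟨L, fun x hx y hy => ?_⟩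
  rw [← heq x hx, ← heq y hy]
  exact hL (hUS hx) (hUS hy)

theorem lipschitzOnWith_iteratedFDeriv_apply {E : Type*} [NormedAddCommGroup E] [NormedSpace ℝ E]
    {n : ℕ} {f : E → ℂ} {U : Set E} {L : NNReal}
    (hL : LipschitzOnWith L (iteratedFDeriv ℝ n f) U) {v : Fin n → E} (hv : ∀ i, ‖v i‖ ≤ 1) :
    LipschitzOnWith L (fun x => iteratedFDeriv ℝ n f x v) U := by
  refine LipschitzOnWith.of_dist_le_mul fun x hx y hy => ?_
  rw [dist_eq_norm, ← sub_apply]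
  refine (ContinuousMultilinearMap.le_opNorm _ _).trans ?_
  rw [← dist_eq_norm]
  refine (mul_le_of_le_one_right dist_nonneg ?_).trans (hL.dist_le_mul x hx y hy)
  exact Finset.prod_le_one (fun _ _ => norm_nonneg _) fun i _ => hv i

theorem ContDiffLip.diffLip {a b : ℝ} (hab : a < b) {n : ℕ} {f : ℝ → ℂ}
    (hf : ContDiffLip n f (Set.Icc a b)) :
    DiffLip a b n (linftyENorm (iteratedDeriv (n + 1) f) (Set.Ioo a b)).toReal f := by
  obtain ⟨L, hL⟩ := hf.exists_lipschitzOnWith (uniqueDiffOn_Icc hab) isOpen_Ioo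
    Set.Ioo_subset_Icc_self
  have hL' : LipschitzOnWith L (iteratedDeriv n f) (Set.Ioo a b) :=
    lipschitzOnWith_iteratedFDeriv_apply hL (v := fun _ => 1) (by simp)
  refine diffLip_of_contDiffOn (hf.1.mono Set.Ioo_subset_Icc_self)
    (norm_sub_le_of_ae_norm_deriv_le hL' ?_)
  rw [← iteratedDeriv_succ]
  refine ae_norm_le_of_linftyENorm_le ENNReal.toReal_nonneg (le_of_eq ?_)
  rw [ENNReal.ofReal_toReal]
  -- `toReal` would turn `∞` into `0`; the qualitative constant `L` excludes this.
  refine ne_top_of_le_ne_top ENNReal.ofReal_ne_top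
    (linftyENorm_le (C := L) measurableSet_Ioo fun x hx => ?_)
  rw [iteratedDeriv_succ]
  exact norm_deriv_le_of_lipschitzOn (Ioo_mem_nhds hx.1 hx.2) hL'

theorem isQuadratureErrorConstant_quadratureConst {k : ℕ} (hk : 1 ≤ k) :
    IsQuadratureErrorConstant k (quadratureConst k) := by
  intro a b hab f hf Q ν hpos hν hkν
  have hd := hf.diffLip hab
  rw [Nat.sub_add_cancel hk] at hd
  exact norm_apply_sub_integral_le_of_diffLip hab hpos hν hk hkν hf.1.continuousOn
    ENNReal.toReal_nonneg hd

/-- The subset of `U` where `φ > c` is open and null, hence empty. -/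
theorem le_of_ae_le_of_continuousOn {X : Type*} [TopologicalSpace X] [MeasureSpace X]
    [OpensMeasurableSpace X] [(volume : Measure X).IsOpenPosMeasure] {U : Set X} (hU : IsOpen U)
    {φ : X → ℝ} (hφ : ContinuousOn φ U) {c : ℝ} (h : ∀ᵐ p ∂volume.restrict U, φ p ≤ c) :
    ∀ p ∈ U, φ p ≤ c := by
  have hV : IsOpen (U ∩ φ ⁻¹' Set.Ioi c) := hφ.isOpen_inter_preimage hU isOpen_Ioi
  have h0 : volume (U ∩ φ ⁻¹' Set.Ioi c) = 0 := by
    rw [ae_restrict_iff' hU.measurableSet] at h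
    refine measure_mono_null (fun p hp => ?_) h
    simp only [Set.mem_compl_iff, Set.mem_ofPred_eq]
    exact fun hq => absurd (hq hp.1) (not_le.2 hp.2)
  have := hV.measure_eq_zero_iff volume |>.1 h0
  intro p hp
  by_contra hc
  exact (this ▸ (⟨hp, not_le.1 hc⟩ : p ∈ U ∩ φ ⁻¹' Set.Ioi c) : p ∈ (∅ : Set X))

/-! ### Iterated partial derivatives of a kernel of class `C^n` on an open set. -/

section Partials

variable {U : Set (ℝ × ℝ)} {K : ℝ × ℝ → ℂ} {n : ℕ}

theorem hasDerivAt_fst_of_differentiableAt {G : ℝ × ℝ → ℂ} {p : ℝ × ℝ}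
    (h : DifferentiableAt ℝ G p) :
    HasDerivAt (fun x => G (x, p.2)) (fderiv ℝ G p (1, 0)) p.1 :=
  h.hasFDerivAt.comp_hasDerivAt p.1 ((hasDerivAt_id p.1).prodMk (hasDerivAt_const p.1 p.2))

theorem hasDerivAt_snd_of_differentiableAt {G : ℝ × ℝ → ℂ} {p : ℝ × ℝ}
    (h : DifferentiableAt ℝ G p) :
    HasDerivAt (fun y => G (p.1, y)) (fderiv ℝ G p (0, 1)) p.2 :=
  h.hasFDerivAt.comp_hasDerivAt p.2 ((hasDerivAt_const p.2 p.1).prodMk (hasDerivAt_id p.2))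

theorem partialDeriv_succ_left (i j : ℕ) (K : ℝ × ℝ → ℂ) (p : ℝ × ℝ) :
    partialDeriv (i + 1) j K p = deriv (fun x => partialDeriv i j K (x, p.2)) p.1 := by
  unfold partialDeriv
  rw [iteratedDeriv_succ]

theorem partialDeriv_zero_succ (j : ℕ) (K : ℝ × ℝ → ℂ) (p : ℝ × ℝ) :
    partialDeriv 0 (j + 1) K p = deriv (fun y => partialDeriv 0 j K (p.1, y)) p.2 := by
  unfold partialDeriv
  simp only [iteratedDeriv_zero, iteratedDeriv_succ]

theorem contDiffOn_fderiv_apply {G : ℝ × ℝ → ℂ} {r : ℕ} (hU : IsOpen U)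
    (hG : ContDiffOn ℝ (r + 1 : ℕ) G U) (v : ℝ × ℝ) :
    ContDiffOn ℝ r (fun p => fderiv ℝ G p v) U :=
  (hG.fderiv_of_isOpen hU (by norm_cast)).clm_apply contDiffOn_const

theorem differentiableAt_of_contDiffOn_succ {G : ℝ × ℝ → ℂ} {r : ℕ} (hU : IsOpen U)
    (hG : ContDiffOn ℝ (r + 1 : ℕ) G U) {p : ℝ × ℝ} (hp : p ∈ U) : DifferentiableAt ℝ G p :=
  (hG.contDiffAt (hU.mem_nhds hp)).differentiableAt (by simp)

theorem contDiffOn_partialDeriv (hU : IsOpen U) (hK : ContDiffOn ℝ n K U) {i j r : ℕ}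
    (h : i + j + r = n) : ContDiffOn ℝ r (partialDeriv i j K) U := by
  induction i generalizing r with
  | zero =>
    induction j generalizing r with
    | zero =>
      obtain rfl : r = n := by omega
      exact hK
    | succ j ih =>
      have hG := ih (r := r + 1) (by omega)
      refine (contDiffOn_fderiv_apply hU hG (0, 1)).congr fun p hp => ?_
      rw [partialDeriv_zero_succ]
      exact (hasDerivAt_snd_of_differentiableAt
        (differentiableAt_of_contDiffOn_succ hU hG hp)).deriv
  | succ i ih =>
    have hG := ih (r := r + 1) (by omega)
    refine (contDiffOn_fderiv_apply hU hG (1, 0)).congr fun p hp => ?_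
    rw [partialDeriv_succ_left]
    exact (hasDerivAt_fst_of_differentiableAt
      (differentiableAt_of_contDiffOn_succ hU hG hp)).deriv

theorem differentiableAt_partialDeriv (hU : IsOpen U) (hK : ContDiffOn ℝ n K U) {i j : ℕ}
    (h : i + j < n) {p : ℝ × ℝ} (hp : p ∈ U) : DifferentiableAt ℝ (partialDeriv i j K) p :=
  differentiableAt_of_contDiffOn_succ hU
    (contDiffOn_partialDeriv hU hK (r := n - (i + j) - 1 + 1) (by omega)) hp

theorem fderiv_partialDeriv_left (hU : IsOpen U) (hK : ContDiffOn ℝ n K U) {i j : ℕ}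
    (h : i + j < n) {p : ℝ × ℝ} (hp : p ∈ U) :
    fderiv ℝ (partialDeriv i j K) p (1, 0) = partialDeriv (i + 1) j K p := by
  rw [partialDeriv_succ_left]
  exact (hasDerivAt_fst_of_differentiableAt (differentiableAt_partialDeriv hU hK h hp)).deriv.symm

/-- `partialDeriv` takes the derivatives in the second variable first, so one more of them must be
moved inside past each `∂₁`. Symmetry of second derivatives does this, one `∂₁` per induction step.
-/
theorem fderiv_partialDeriv_right (hU : IsOpen U) (hK : ContDiffOn ℝ n K U) {i j : ℕ}
    (h : i + j < n) {p : ℝ × ℝ} (hp : p ∈ U) :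
    fderiv ℝ (partialDeriv i j K) p (0, 1) = partialDeriv i (j + 1) K p := by
  induction i generalizing p with
  | zero =>
    rw [partialDeriv_zero_succ]
    exact (hasDerivAt_snd_of_differentiableAt
      (differentiableAt_partialDeriv hU hK h hp)).deriv.symm
  | succ i ih =>
    set G := partialDeriv i j K with hG
    have hGc : ContDiffOn ℝ (2 : ℕ) G U :=
      (contDiffOn_partialDeriv hU hK (r := n - (i + j)) (by omega)).of_le
        (by norm_cast; omega)
    have hGp : ContDiffAt ℝ (2 : ℕ) G p := hGc.contDiffAt (hU.mem_nhds hp)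
    have hd : DifferentiableAt ℝ (fderiv ℝ G) p :=
      (hGp.fderiv_right (m := 1) (by norm_num)).differentiableAt (by simp)
    have hcomp : ∀ v w : ℝ × ℝ, fderiv ℝ (fun q => fderiv ℝ G q v) p w
        = fderiv ℝ (fderiv ℝ G) p w v := by
      intro v w
      rw [fderiv_clm_apply hd (differentiableAt_const v)]
      simp
    have e1 : partialDeriv (i + 1) j K =ᶠ[nhds p] fun q => fderiv ℝ G q (1, 0) :=
      Filter.eventuallyEq_of_mem (hU.mem_nhds hp) fun q hq =>
        (fderiv_partialDeriv_left hU hK (by omega) hq).symm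
    have e2 : partialDeriv i (j + 1) K =ᶠ[nhds p] fun q => fderiv ℝ G q (0, 1) :=
      Filter.eventuallyEq_of_mem (hU.mem_nhds hp) fun q hq => (ih (by omega) hq).symm
    have hsymm : IsSymmSndFDerivAt ℝ G p := hGp.isSymmSndFDerivAt (by simp)
    rw [e1.fderiv_eq, hcomp, hsymm, ← hcomp, ← e2.fderiv_eq]
    exact fderiv_partialDeriv_left hU hK (by omega) hp

/-- Directions of norm at most one let bounds and Lipschitz constants of the full derivative pass to
the partial derivatives. -/
theorem exists_partialDeriv_eq_iteratedFDeriv (hU : IsOpen U) (hK : ContDiffOn ℝ n K U)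
    {i j m : ℕ} (hm : i + j = m) (hmn : m ≤ n) :
    ∃ v : Fin m → ℝ × ℝ, (∀ l, ‖v l‖ ≤ 1) ∧
      ∀ p ∈ U, partialDeriv i j K p = iteratedFDeriv ℝ m K p v := by
  have step : ∀ {m : ℕ} {G G' : ℝ × ℝ → ℂ} {v : Fin m → ℝ × ℝ} {e : ℝ × ℝ}, m + 1 ≤ n →
      (∀ l, ‖v l‖ ≤ 1) → (∀ p ∈ U, G p = iteratedFDeriv ℝ m K p v) → ‖e‖ ≤ 1 →
      (∀ p ∈ U, fderiv ℝ G p e = G' p) →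
      ∃ w : Fin (m + 1) → ℝ × ℝ, (∀ l, ‖w l‖ ≤ 1) ∧
        ∀ p ∈ U, G' p = iteratedFDeriv ℝ (m + 1) K p w := by
    intro m G G' v e hm hv hG he hG'
    refine ⟨Fin.cons e v, fun l => Fin.cases he hv l, fun p hp => ?_⟩
    have hd : DifferentiableAt ℝ (iteratedFDeriv ℝ m K) p :=
      (hK.contDiffAt (hU.mem_nhds hp)).differentiableAt_iteratedFDeriv (by exact_mod_cast hm)
    rw [hd.iteratedFDeriv_succ_apply_left', ← hG' p hp,
      (Filter.eventuallyEq_of_mem (hU.mem_nhds hp) hG).fderiv_eq]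
    simp
  induction i generalizing m with
  | zero =>
    induction j generalizing m with
    | zero =>
      obtain rfl : m = 0 := by omega
      exact ⟨fun _ => 0, by simp, fun p _ => by simp [partialDeriv]⟩
    | succ j ih =>
      obtain ⟨v, hv, hG⟩ := ih (m := j) (by omega) (by omega)
      obtain rfl : m = j + 1 := by omega
      exact step hmn hv hG (e := (0, 1)) (by simp) fun p hp =>
        fderiv_partialDeriv_right hU hK (by omega) hp
  | succ i ih =>
    obtain ⟨v, hv, hG⟩ := ih (m := i + j) rfl (by omega)
    obtain rfl : m = i + j + 1 := by omega
    exact step hmn hv hG (e := (1, 0)) (by simp) fun p hp =>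
      fderiv_partialDeriv_left hU hK (by omega) hp

end Partials

/-! ### From the kernel norm to pointwise bounds and sharp Lipschitz constants. -/

/-- A family `g i j`, `i + j ≤ n`, of successive partial derivatives on the open square `(a, b)²`,
bounded by `N` and Lipschitz continuous with constant `N` in each variable. -/
structure KernelJet (a b : ℝ) (n : ℕ) (N : ℝ) (g : ℕ → ℕ → ℝ × ℝ → ℂ) : Prop where
  bound : ∀ i j, i + j ≤ n → ∀ x ∈ Set.Ioo a b, ∀ y ∈ Set.Ioo a b, ‖g i j (x, y)‖ ≤ N
  lip_fst : ∀ i j, i + j ≤ n → ∀ y ∈ Set.Ioo a b, ∀ x ∈ Set.Ioo a b, ∀ x' ∈ Set.Ioo a b,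
    ‖g i j (x, y) - g i j (x', y)‖ ≤ N * |x - x'|
  lip_snd : ∀ i j, i + j ≤ n → ∀ x ∈ Set.Ioo a b, ∀ y ∈ Set.Ioo a b, ∀ y' ∈ Set.Ioo a b,
    ‖g i j (x, y) - g i j (x, y')‖ ≤ N * |y - y'|
  hasDerivAt_fst : ∀ i j, i + j < n → ∀ x ∈ Set.Ioo a b, ∀ y ∈ Set.Ioo a b,
    HasDerivAt (fun s => g i j (s, y)) (g (i + 1) j (x, y)) x
  hasDerivAt_snd : ∀ i j, i + j < n → ∀ x ∈ Set.Ioo a b, ∀ y ∈ Set.Ioo a b,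
    HasDerivAt (fun s => g i j (x, s)) (g i (j + 1) (x, y)) y
  hasDerivAt_diag : ∀ i j, i + j < n → ∀ s ∈ Set.Ioo a b,
    HasDerivAt (fun s => g i j (s, s)) (g (i + 1) j (s, s) + g i (j + 1) (s, s)) s

section

variable {a b : ℝ} {n : ℕ} {K : ℝ × ℝ → ℂ}

theorem isOpen_Ioo_prod_Ioo : IsOpen (Set.Ioo a b ×ˢ Set.Ioo a b) := isOpen_Ioo.prod isOpen_Ioo

theorem exists_lipschitzOnWith_partialDeriv (hab : a < b)
    (hK : ContDiffLip n K (Set.Icc a b ×ˢ Set.Icc a b)) :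
    ∃ L : NNReal, ∀ i j, i + j = n →
      LipschitzOnWith L (partialDeriv i j K) (Set.Ioo a b ×ˢ Set.Ioo a b) := by
  have hsub : Set.Ioo a b ×ˢ Set.Ioo a b ⊆ Set.Icc a b ×ˢ Set.Icc a b :=
    Set.prod_mono Set.Ioo_subset_Icc_self Set.Ioo_subset_Icc_self
  obtain ⟨L, hL⟩ := hK.exists_lipschitzOnWith
    ((uniqueDiffOn_Icc hab).prod (uniqueDiffOn_Icc hab)) isOpen_Ioo_prod_Ioo hsub
  refine ⟨L, fun i j hij => ?_⟩
  obtain ⟨v, hv, hg⟩ := exists_partialDeriv_eq_iteratedFDeriv isOpen_Ioo_prod_Ioo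
    (hK.1.mono hsub) hij le_rfl
  intro p hp q hq
  rw [hg p hp, hg q hq]
  exact lipschitzOnWith_iteratedFDeriv_apply hL hv hp hq

theorem lipschitzOnWith_slice_fst {G : ℝ × ℝ → ℂ} {L : NNReal}
    (hG : LipschitzOnWith L G (Set.Ioo a b ×ˢ Set.Ioo a b)) {y : ℝ} (hy : y ∈ Set.Ioo a b) :
    LipschitzOnWith L (fun x => G (x, y)) (Set.Ioo a b) := by
  intro x hx x' hx'
  simpa [Prod.edist_eq] using hG (Set.mk_mem_prod hx hy) (Set.mk_mem_prod hx' hy)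

theorem lipschitzOnWith_slice_snd {G : ℝ × ℝ → ℂ} {L : NNReal}
    (hG : LipschitzOnWith L G (Set.Ioo a b ×ˢ Set.Ioo a b)) {x : ℝ} (hx : x ∈ Set.Ioo a b) :
    LipschitzOnWith L (fun y => G (x, y)) (Set.Ioo a b) := by
  intro y hy y' hy'
  simpa [Prod.edist_eq] using hG (Set.mk_mem_prod hx hy) (Set.mk_mem_prod hx hy')

/-- Needed so that the supremum in `kernelNorm` is finite and `toReal` loses nothing. Up to order
`n`, continuity on the compact square suffices; at order `n + 1` the Lipschitz constant bounds the
derivative. -/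
theorem exists_bound_partialDeriv (hab : a < b)
    (hK : ContDiffLip n K (Set.Icc a b ×ˢ Set.Icc a b)) {i j : ℕ} (hij : i + j ≤ n + 1) :
    ∃ C : ℝ, ∀ p ∈ Set.Ioo a b ×ˢ Set.Ioo a b, ‖partialDeriv i j K p‖ ≤ C := by
  have hsub : Set.Ioo a b ×ˢ Set.Ioo a b ⊆ Set.Icc a b ×ˢ Set.Icc a b :=
    Set.prod_mono Set.Ioo_subset_Icc_self Set.Ioo_subset_Icc_self
  have hud := (uniqueDiffOn_Icc hab).prod (uniqueDiffOn_Icc hab)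
  rcases Nat.lt_or_ge n (i + j) with h | h
  · obtain ⟨L, hL⟩ := exists_lipschitzOnWith_partialDeriv hab hK
    refine ⟨L, fun p hp => ?_⟩
    rcases i with - | i
    · obtain rfl : j = n + 1 := by omega
      rw [partialDeriv_zero_succ]
      exact norm_deriv_le_of_lipschitzOn (Ioo_mem_nhds hp.2.1 hp.2.2)
        (lipschitzOnWith_slice_snd (hL 0 n (by omega)) hp.1)
    · rw [partialDeriv_succ_left]
      exact norm_deriv_le_of_lipschitzOn (Ioo_mem_nhds hp.1.1 hp.1.2)
        (lipschitzOnWith_slice_fst (hL i j (by omega)) hp.2)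
  · obtain ⟨v, hv, hg⟩ := exists_partialDeriv_eq_iteratedFDeriv isOpen_Ioo_prod_Ioo
      (hK.1.mono hsub) (rfl : i + j = i + j) h
    have hc : ContinuousOn (iteratedFDerivWithin ℝ (i + j) K (Set.Icc a b ×ˢ Set.Icc a b))
        (Set.Icc a b ×ˢ Set.Icc a b) :=
      hK.1.continuousOn_iteratedFDerivWithin (by exact_mod_cast h) hud
    obtain ⟨C, hC⟩ := (isCompact_Icc.prod isCompact_Icc).exists_bound_of_continuousOn hc
    refine ⟨C, fun p hp => ?_⟩
    have hKp : ContDiffAt ℝ (i + j : ℕ) K p :=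
      (hK.1.contDiffAt (Filter.mem_of_superset (isOpen_Ioo_prod_Ioo.mem_nhds hp) hsub)).of_le
        (by exact_mod_cast h)
    rw [hg p hp, ← iteratedFDerivWithin_eq_iteratedFDeriv hud hKp (hsub hp)]
    refine (ContinuousMultilinearMap.le_opNorm _ _).trans ?_
    exact (mul_le_of_le_one_right (norm_nonneg _)
      (Finset.prod_le_one (fun _ _ => norm_nonneg _) fun i _ => hv i)).trans (hC p (hsub hp))

theorem ae_norm_partialDeriv_le_kernelNorm (hab : a < b)
    (hK : ContDiffLip n K (Set.Icc a b ×ˢ Set.Icc a b)) {i j : ℕ} (hij : i + j ≤ n + 1) :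
    ∀ᵐ p ∂volume.restrict (Set.Ioo a b ×ˢ Set.Ioo a b),
      ‖partialDeriv i j K p‖ ≤ kernelNorm a b (n + 1) K := by
  set F : ℕ → ℕ → ℝ≥0∞ := fun i j =>
    linftyENorm (partialDeriv i j K) (Set.Ioo a b ×ˢ Set.Ioo a b)
  have hfin : ∀ i j, i + j ≤ n + 1 → F i j < ⊤ := fun i j h => by
    obtain ⟨C, hC⟩ := exists_bound_partialDeriv hab hK h
    exact (linftyENorm_le isOpen_Ioo_prod_Ioo.measurableSet hC).trans_lt ENNReal.ofReal_lt_top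
  have hsup : (⨆ (i : ℕ) (j : ℕ) (_ : i + j ≤ n + 1), F i j) ≠ ⊤ := by
    set s := ((Finset.range (n + 2)) ×ˢ (Finset.range (n + 2))).filter (fun q => q.1 + q.2 ≤ n + 1)
    have hs : ∑ q ∈ s, F q.1 q.2 < ⊤ :=
      ENNReal.sum_lt_top.2 fun q hq => hfin _ _ (Finset.mem_filter.1 hq).2
    refine ne_top_of_le_ne_top hs.ne (iSup_le fun i => iSup_le fun j => iSup_le fun h => ?_)
    refine Finset.single_le_sum (f := fun q : ℕ × ℕ => F q.1 q.2) (fun _ _ => bot_le)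
      (a := (i, j)) ?_
    simp only [s, Finset.mem_filter, Finset.mem_product, Finset.mem_range]
    omega
  refine ae_norm_le_of_linftyENorm_le ENNReal.toReal_nonneg ?_
  rw [kernelNorm, ENNReal.ofReal_toReal hsup]
  exact le_iSup_of_le i (le_iSup_of_le j (le_iSup_of_le hij le_rfl))

theorem kernelNorm_nonneg (a b : ℝ) (k : ℕ) (K : ℝ × ℝ → ℂ) : 0 ≤ kernelNorm a b k K :=
  ENNReal.toReal_nonneg

theorem volume_restrict_square : (volume : Measure (ℝ × ℝ)).restrict (Set.Ioo a b ×ˢ Set.Ioo a b)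
    = (volume.restrict (Set.Ioo a b)).prod (volume.restrict (Set.Ioo a b)) := by
  rw [Measure.volume_eq_prod, Measure.prod_restrict]

/-- A Lipschitz function on the square whose first partial derivative is at most `N` almost
everywhere is Lipschitz in the first variable with constant `N`. -/
theorem lip_fst_of_ae {G G' : ℝ × ℝ → ℂ} {L : NNReal} {N : ℝ}
    (hG : LipschitzOnWith L G (Set.Ioo a b ×ˢ Set.Ioo a b))
    (hG' : ∀ p, G' p = deriv (fun x => G (x, p.2)) p.1)
    (h : ∀ᵐ p ∂volume.restrict (Set.Ioo a b ×ˢ Set.Ioo a b), ‖G' p‖ ≤ N) :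
    ∀ y ∈ Set.Ioo a b, ∀ x ∈ Set.Ioo a b, ∀ x' ∈ Set.Ioo a b,
      ‖G (x, y) - G (x', y)‖ ≤ N * |x - x'| := by
  intro y hy x hx x' hx'
  rw [volume_restrict_square] at h
  -- By Fubini almost every horizontal slice obeys the derivative bound almost everywhere;
  -- continuity in `y` then gives every slice.
  have h' := Measure.ae_ae_of_ae_prod
    ((Measure.measurePreserving_swap (μ := volume.restrict (Set.Ioo a b))
      (ν := volume.restrict (Set.Ioo a b))).quasiMeasurePreserving.ae h)
  refine le_of_ae_le_of_continuousOn (φ := fun y => ‖G (x, y) - G (x', y)‖) isOpen_Ioo ?_ ?_ y hy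
  · exact ((lipschitzOnWith_slice_snd hG hx).continuousOn.sub
      (lipschitzOnWith_slice_snd hG hx').continuousOn).norm
  · filter_upwards [h', ae_restrict_mem measurableSet_Ioo] with y hy hyI
    refine norm_sub_le_of_ae_norm_deriv_le (lipschitzOnWith_slice_fst hG hyI) ?_ x hx x' hx'
    filter_upwards [hy] with t ht
    simpa [hG'] using ht

theorem lip_snd_of_ae {G G' : ℝ × ℝ → ℂ} {L : NNReal} {N : ℝ}
    (hG : LipschitzOnWith L G (Set.Ioo a b ×ˢ Set.Ioo a b))
    (hG' : ∀ p, G' p = deriv (fun y => G (p.1, y)) p.2)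
    (h : ∀ᵐ p ∂volume.restrict (Set.Ioo a b ×ˢ Set.Ioo a b), ‖G' p‖ ≤ N) :
    ∀ x ∈ Set.Ioo a b, ∀ y ∈ Set.Ioo a b, ∀ y' ∈ Set.Ioo a b,
      ‖G (x, y) - G (x, y')‖ ≤ N * |y - y'| := by
  intro x hx y hy y' hy'
  rw [volume_restrict_square] at h
  have h' := Measure.ae_ae_of_ae_prod h
  refine le_of_ae_le_of_continuousOn (φ := fun x => ‖G (x, y) - G (x, y')‖) isOpen_Ioo ?_ ?_ x hx
  · exact ((lipschitzOnWith_slice_fst hG hy).continuousOn.sub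
      (lipschitzOnWith_slice_fst hG hy').continuousOn).norm
  · filter_upwards [h', ae_restrict_mem measurableSet_Ioo] with x hx hxI
    refine norm_sub_le_of_ae_norm_deriv_le (lipschitzOnWith_slice_snd hG hxI) ?_ y hy y' hy'
    filter_upwards [hx] with t ht
    simpa [hG'] using ht

theorem norm_sub_le_of_hasDerivAt_le {f f' : ℝ → ℂ} {N : ℝ}
    (hf : ∀ x ∈ Set.Ioo a b, HasDerivAt f (f' x) x) (hN : ∀ x ∈ Set.Ioo a b, ‖f' x‖ ≤ N) :
    ∀ x ∈ Set.Ioo a b, ∀ y ∈ Set.Ioo a b, ‖f x - f y‖ ≤ N * |x - y| := by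
  intro x hx y hy
  simpa [Real.norm_eq_abs] using (convex_Ioo a b).norm_image_sub_le_of_norm_hasDerivWithin_le
    (fun t ht => (hf t ht).hasDerivWithinAt) hN hy hx

/-- If `∂₂ u` is Lipschitz with constant `N` in the first variable, then `∂₁ u` is Lipschitz with
constant `N` in the second variable. -/
theorem lip_snd_of_lip_fst {u u₁ u₂ : ℝ × ℝ → ℂ} {N : ℝ}
    (h₁ : ∀ x ∈ Set.Ioo a b, ∀ y ∈ Set.Ioo a b, HasDerivAt (fun s => u (s, y)) (u₁ (x, y)) x)
    (h₂ : ∀ x ∈ Set.Ioo a b, ∀ y ∈ Set.Ioo a b, HasDerivAt (fun s => u (x, s)) (u₂ (x, y)) y)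
    (hN : 0 ≤ N)
    (h : ∀ y ∈ Set.Ioo a b, ∀ x ∈ Set.Ioo a b, ∀ x' ∈ Set.Ioo a b,
      ‖u₂ (x, y) - u₂ (x', y)‖ ≤ N * |x - x'|) :
    ∀ x ∈ Set.Ioo a b, ∀ y ∈ Set.Ioo a b, ∀ y' ∈ Set.Ioo a b,
      ‖u₁ (x, y) - u₁ (x, y')‖ ≤ N * |y - y'| := by
  intro x hx y hy y' hy'
  have hd : HasDerivAt (fun s => u (s, y) - u (s, y')) (u₁ (x, y) - u₁ (x, y')) x :=
    (h₁ x hx y hy).sub (h₁ x hx y' hy')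
  refine hd.le_of_lip' (by positivity) ?_
  filter_upwards [Ioo_mem_nhds hx.1 hx.2] with s hs
  -- The mixed second difference is at most `N |s - x| |y - y'|`; dividing by `|s - x|` and letting
  -- `s → x` yields the claim.
  have := norm_sub_le_of_hasDerivAt_le (f := fun t => u (s, t) - u (x, t))
    (fun t ht => (h₂ s hs t ht).sub (h₂ x hx t ht)) (fun t ht => h t ht s hs x hx) y hy y' hy'
  rw [sub_sub_sub_comm, Real.norm_eq_abs]
  calc _ ≤ N * |s - x| * |y - y'| := this
    _ = _ := by ring

theorem kernelJet_partialDeriv (hab : a < b)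
    (hK : ContDiffLip n K (Set.Icc a b ×ˢ Set.Icc a b)) :
    KernelJet a b n (kernelNorm a b (n + 1) K) (fun i j => partialDeriv i j K) := by
  have hN := kernelNorm_nonneg a b (n + 1) K
  have hsub : Set.Ioo a b ×ˢ Set.Ioo a b ⊆ Set.Icc a b ×ˢ Set.Icc a b :=
    Set.prod_mono Set.Ioo_subset_Icc_self Set.Ioo_subset_Icc_self
  have hU := isOpen_Ioo_prod_Ioo (a := a) (b := b)
  have hc := hK.1.mono hsub
  obtain ⟨L, hL⟩ := exists_lipschitzOnWith_partialDeriv hab hK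
  have hbound : ∀ i j, i + j ≤ n → ∀ x ∈ Set.Ioo a b, ∀ y ∈ Set.Ioo a b,
      ‖partialDeriv i j K (x, y)‖ ≤ kernelNorm a b (n + 1) K := fun i j hij x hx y hy =>
    le_of_ae_le_of_continuousOn hU
      (contDiffOn_partialDeriv hU hc (r := n - (i + j)) (by omega)).continuousOn.norm
      (ae_norm_partialDeriv_le_kernelNorm hab hK (by omega)) (x, y) ⟨hx, hy⟩
  have hd1 : ∀ i j, i + j < n → ∀ x ∈ Set.Ioo a b, ∀ y ∈ Set.Ioo a b,
      HasDerivAt (fun s => partialDeriv i j K (s, y)) (partialDeriv (i + 1) j K (x, y)) x := by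
    intro i j hij x hx y hy
    have hp : (x, y) ∈ Set.Ioo a b ×ˢ Set.Ioo a b := ⟨hx, hy⟩
    rw [← fderiv_partialDeriv_left hU hc hij hp]
    exact hasDerivAt_fst_of_differentiableAt (differentiableAt_partialDeriv hU hc hij hp)
  have hd2 : ∀ i j, i + j < n → ∀ x ∈ Set.Ioo a b, ∀ y ∈ Set.Ioo a b,
      HasDerivAt (fun s => partialDeriv i j K (x, s)) (partialDeriv i (j + 1) K (x, y)) y := by
    intro i j hij x hx y hy
    have hp : (x, y) ∈ Set.Ioo a b ×ˢ Set.Ioo a b := ⟨hx, hy⟩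
    rw [← fderiv_partialDeriv_right hU hc hij hp]
    exact hasDerivAt_snd_of_differentiableAt (differentiableAt_partialDeriv hU hc hij hp)
  have hl1 : ∀ i j, i + j ≤ n → ∀ y ∈ Set.Ioo a b, ∀ x ∈ Set.Ioo a b, ∀ x' ∈ Set.Ioo a b,
      ‖partialDeriv i j K (x, y) - partialDeriv i j K (x', y)‖
        ≤ kernelNorm a b (n + 1) K * |x - x'| := by
    intro i j hij y hy
    rcases hij.lt_or_eq with h | h
    · exact norm_sub_le_of_hasDerivAt_le (fun x hx => hd1 i j h x hx y hy)
        fun x hx => hbound (i + 1) j (by omega) x hx y hy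
    · exact lip_fst_of_ae (hL i j h) (partialDeriv_succ_left i j K)
        (ae_norm_partialDeriv_le_kernelNorm hab hK (by omega)) y hy
  refine ⟨hbound, hl1, ?_, hd1, hd2, ?_⟩
  · intro i j hij
    rcases hij.lt_or_eq with h | h
    · exact fun x hx => norm_sub_le_of_hasDerivAt_le (fun y hy => hd2 i j h x hx y hy)
        fun y hy => hbound i (j + 1) (by omega) x hx y hy
    -- At top order with a derivative in the first variable, `∂₂` of this function is not of the
    -- form `partialDeriv`, and symmetry is not available at order `n + 1`. The constant comes
    -- instead from `∂₁^i ∂₂^(j+1)`, with the new `i`, as a function of the first variable.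
    · rcases i with - | i
      · exact lip_snd_of_ae (hL 0 j h) (partialDeriv_zero_succ j K)
          (ae_norm_partialDeriv_le_kernelNorm hab hK (by omega))
      · exact lip_snd_of_lip_fst (hd1 i j (by omega)) (hd2 i j (by omega)) hN
          (hl1 i (j + 1) (by omega))
  · intro i j hij s hs
    have hp : (s, s) ∈ Set.Ioo a b ×ˢ Set.Ioo a b := ⟨hs, hs⟩
    have := (differentiableAt_partialDeriv hU hc hij hp).hasFDerivAt.comp_hasDerivAt
      (f := fun t : ℝ => (t, t)) s ((hasDerivAt_id s).prodMk (hasDerivAt_id s))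
    rw [← fderiv_partialDeriv_left hU hc hij hp, ← fderiv_partialDeriv_right hU hc hij hp,
      ← map_add, Prod.mk_add_mk, add_zero, zero_add]
    exact this

end

/-! ### Differentiating the determinants in one variable. -/

/-- The matrix of `K_m` with `∂₁^i` applied to row `J`, evaluated at `x`, and `∂₂^j` applied to
column `J`, evaluated at `y`. -/
def jetMatrix {m : ℕ} (g : ℕ → ℕ → ℝ × ℝ → ℂ) (t : Fin m → ℝ) (J : Fin m) (i j : ℕ) (x y : ℝ) :
    Matrix (Fin m) (Fin m) ℂ :=
  Matrix.of fun p q =>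
    if p = J then (if q = J then g i j (x, y) else g i 0 (x, t q))
    else if q = J then g 0 j (t p, y) else g 0 0 (t p, t q)

section

variable {a b : ℝ} {n m : ℕ} {N : ℝ} {g : ℕ → ℕ → ℝ × ℝ → ℂ} {t : Fin m → ℝ}

/-- In a Leibniz term, `s` occurs either in the diagonal entry alone (`σ J = J`) or in two entries,
one from row `J` and one from column `J`. The chain rule on the diagonal, respectively the product
rule, splits the derivative in the same way. -/
theorem KernelJet.hasDerivAt_prod (hg : KernelJet a b n N g) (ht : ∀ p, t p ∈ Set.Ioo a b)
    (J : Fin m) {i j : ℕ} (hij : i + j < n) {s : ℝ} (hs : s ∈ Set.Ioo a b)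
    (σ : Equiv.Perm (Fin m)) :
    HasDerivAt (fun s => ∏ q, jetMatrix g t J i j s s (σ q) q)
      ((∏ q, jetMatrix g t J (i + 1) j s s (σ q) q)
        + ∏ q, jetMatrix g t J i (j + 1) s s (σ q) q) s := by
  by_cases hJ : σ J = J
  · set R : ℂ := ∏ q ∈ Finset.univ.erase J, g 0 0 (t (σ q), t q)
    have key : ∀ i j s, ∏ q, jetMatrix g t J i j s s (σ q) q = g i j (s, s) * R := by
      intro i j s
      rw [← Finset.mul_prod_erase _ _ (Finset.mem_univ J)]
      congr 1
      · simp [jetMatrix, hJ]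
      · refine Finset.prod_congr rfl fun q hq => ?_
        have h1 : q ≠ J := Finset.ne_of_mem_erase hq
        have h2 : σ q ≠ J := fun h => h1 (σ.injective (h.trans hJ.symm))
        simp [jetMatrix, h1, h2]
    simp only [key, ← add_mul]
    exact (hg.hasDerivAt_diag i j hij s hs).mul_const R
  · set c := σ.symm J with hc
    have hσc : σ c = J := σ.apply_symm_apply J
    have hcJ : c ≠ J := fun h => hJ (by rw [← h, hσc, h])
    set R : ℂ := ∏ q ∈ (Finset.univ.erase J).erase c, g 0 0 (t (σ q), t q)
    have key : ∀ i j s, ∏ q, jetMatrix g t J i j s s (σ q) q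
        = g 0 j (t (σ J), s) * g i 0 (s, t c) * R := by
      intro i j s
      rw [← Finset.mul_prod_erase _ _ (Finset.mem_univ J),
        ← Finset.mul_prod_erase _ _ (Finset.mem_erase.2 ⟨hcJ, Finset.mem_univ c⟩), ← mul_assoc]
      congr 1
      · simp [jetMatrix, hJ, hσc, hcJ]
      · refine Finset.prod_congr rfl fun q hq => ?_
        have h1 : q ≠ J := Finset.ne_of_mem_erase (Finset.mem_of_mem_erase hq)
        have h2 : σ q ≠ J := fun h =>
          Finset.ne_of_mem_erase hq (σ.injective (h.trans hσc.symm))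
        simp [jetMatrix, h1, h2]
    simp only [key]
    have h1 := hg.hasDerivAt_snd 0 j (by omega) (t (σ J)) (ht _) s hs
    have h2 := hg.hasDerivAt_fst i 0 (by omega) s hs (t c) (ht _)
    refine HasDerivAt.congr_deriv ((h1.mul h2).mul_const R) ?_
    ring

theorem KernelJet.hasDerivAt_det (hg : KernelJet a b n N g) (ht : ∀ p, t p ∈ Set.Ioo a b)
    (J : Fin m) {i j : ℕ} (hij : i + j < n) {s : ℝ} (hs : s ∈ Set.Ioo a b) :
    HasDerivAt (fun s => (jetMatrix g t J i j s s).det)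
      ((jetMatrix g t J (i + 1) j s s).det + (jetMatrix g t J i (j + 1) s s).det) s := by
  simp only [Matrix.det_apply', ← Finset.sum_add_distrib, ← mul_add]
  exact HasDerivAt.fun_sum fun σ _ => (hg.hasDerivAt_prod ht J hij hs σ).const_mul _

/-- Changing one row by at most `δ N` changes the determinant by at most `n^{n/2} N^n δ`. -/
theorem norm_det_sub_det_le {A B : Matrix (Fin m) (Fin m) ℂ} (J : Fin m) {δ : ℝ}
    (hAB : ∀ p q, p ≠ J → A p q = B p q) (hA : ∀ p q, p ≠ J → ‖A p q‖ ≤ N)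
    (hJ : ∀ q, ‖A J q - B J q‖ ≤ N * δ) :
    ‖A.det - B.det‖ ≤ (m : ℝ) ^ ((m : ℝ) / 2) * N ^ m * δ := by
  have h1 : A.det - B.det = (A.updateRow J (A J - B J)).det := by
    have hB : B = A.updateRow J (B J) := by
      ext p q
      rcases eq_or_ne p J with rfl | hp
      · simp
      · simp [hp, hAB p q hp]
    have h2 := Matrix.det_updateRow_add A J (A J - B J) (B J)
    rw [sub_add_cancel, Matrix.updateRow_eq_self, ← hB] at h2
    rw [h2, add_sub_cancel_right]
  rw [h1]
  refine (norm_det_le_prod _ (fun p => N * if p = J then δ else 1) fun p q => ?_).trans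
    (le_of_eq ?_)
  · rcases eq_or_ne p J with rfl | hp
    · simpa using hJ q
    · simpa [hp] using hA p q hp
  · rw [Finset.prod_mul_distrib, Finset.prod_ite_eq' Finset.univ J, Finset.prod_const,
      Finset.card_univ, Fintype.card_fin, if_pos (Finset.mem_univ _), mul_assoc]

theorem KernelJet.norm_jetMatrix_le (hg : KernelJet a b n N g) (ht : ∀ p, t p ∈ Set.Ioo a b)
    (J : Fin m) {i j : ℕ} (hij : i + j ≤ n) {x y : ℝ} (hx : x ∈ Set.Ioo a b)
    (hy : y ∈ Set.Ioo a b) (p q : Fin m) : ‖jetMatrix g t J i j x y p q‖ ≤ N := by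
  simp only [jetMatrix, Matrix.of_apply]
  split_ifs
  · exact hg.bound i j hij x hx y hy
  · exact hg.bound i 0 (by omega) x hx _ (ht q)
  · exact hg.bound 0 j (by omega) _ (ht p) y hy
  · exact hg.bound 0 0 (by omega) _ (ht p) _ (ht q)

/-- Moving the row argument changes row `J` only, and moving the column argument changes column `J`
only; the factor `2` counts these two moves. -/
theorem KernelJet.norm_det_sub_le (hg : KernelJet a b n N g) (ht : ∀ p, t p ∈ Set.Ioo a b)
    (J : Fin m) {i j : ℕ} (hij : i + j ≤ n) {x y : ℝ} (hx : x ∈ Set.Ioo a b)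
    (hy : y ∈ Set.Ioo a b) :
    ‖(jetMatrix g t J i j x x).det - (jetMatrix g t J i j y y).det‖
      ≤ 2 * ((m : ℝ) ^ ((m : ℝ) / 2) * N ^ m) * |x - y| := by
  have h1 : ‖(jetMatrix g t J i j x x).det - (jetMatrix g t J i j y x).det‖
      ≤ (m : ℝ) ^ ((m : ℝ) / 2) * N ^ m * |x - y| := by
    refine norm_det_sub_det_le J (fun p q hp => by simp [jetMatrix, hp])
      (fun p q _ => hg.norm_jetMatrix_le ht J hij hx hx p q) fun q => ?_
    simp only [jetMatrix, Matrix.of_apply, if_true]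
    split_ifs
    · exact hg.lip_fst i j hij x hx x hx y hy
    · exact hg.lip_fst i 0 (by omega) _ (ht q) x hx y hy
  have h2 : ‖(jetMatrix g t J i j y x).det - (jetMatrix g t J i j y y).det‖
      ≤ (m : ℝ) ^ ((m : ℝ) / 2) * N ^ m * |x - y| := by
    rw [← Matrix.det_transpose, ← Matrix.det_transpose (jetMatrix g t J i j y y)]
    refine norm_det_sub_det_le J (fun p q hp => by simp [jetMatrix, hp])
      (fun p q _ => hg.norm_jetMatrix_le ht J hij hy hx q p) fun q => ?_
    simp only [jetMatrix, Matrix.of_apply, Matrix.transpose_apply, if_true]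
    split_ifs
    · exact hg.lip_snd i j hij y hy x hx y hy
    · exact hg.lip_snd 0 j (by omega) _ (ht q) x hx y hy
  calc _ ≤ _ := norm_sub_le_norm_sub_add_norm_sub _ (jetMatrix g t J i j y x).det _
    _ ≤ _ := add_le_add h1 h2
    _ = _ := by ring

/-- Each derivative doubles the number of determinants, and the final Lipschitz estimate doubles
once more. With `r = k - 1` this is the factor `2^k`. -/
theorem KernelJet.diffLip_det (hg : KernelJet a b n N g) (ht : ∀ p, t p ∈ Set.Ioo a b)
    (J : Fin m) {i j r : ℕ} (hr : i + j + r = n) :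
    DiffLip a b r (2 ^ (r + 1) * ((m : ℝ) ^ ((m : ℝ) / 2) * N ^ m))
      (fun s => (jetMatrix g t J i j s s).det) := by
  induction r generalizing i j with
  | zero =>
    intro x hx y hy
    simpa using hg.norm_det_sub_le ht J (by omega) hx hy
  | succ r ih =>
    refine ⟨_, fun s hs => hg.hasDerivAt_det ht J (by omega) hs, ?_⟩
    convert (ih (i := i + 1) (j := j) (by omega)).add (ih (i := i) (j := j + 1) (by omega)) using 1
    ring

end

theorem kernelDet_update_eq_det_jetMatrix {m : ℕ} (K : ℝ × ℝ → ℂ) (t : Fin m → ℝ) (J : Fin m)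
    (s : ℝ) : kernelDet K m (Function.update t J s)
      = (jetMatrix (fun i j => partialDeriv i j K) t J 0 0 s s).det := by
  unfold kernelDet
  congr 1
  ext p q
  simp only [jetMatrix, partialDeriv, iteratedDeriv_zero, Matrix.of_apply, Function.update_apply]
  split_ifs <;> rfl

theorem norm_nystromDet_sub_fredholmDet_le_of_contDiffLip {a b : ℝ} (hab : a < b) {k : ℕ}
    (hk : 1 ≤ k) {K : ℝ × ℝ → ℂ} (hK : ContDiffLip (k - 1) K (Set.Icc a b ×ˢ Set.Icc a b))
    {Q : QuadratureRule a b} (hpos : Q.PositiveWeights) {ν : ℕ} (hν : Q.HasOrder ν)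
    (hkν : k ≤ ν) (z : ℂ) :
    ‖Q.nystromDet K z - fredholmDet a b K z‖ ≤
      quadratureConst k * 2 ^ k * (b - a) ^ k * ((ν : ℝ) ^ k)⁻¹ *
        Phi (‖z‖ * (b - a) * kernelNorm a b k K) := by
  have hjet := kernelJet_partialDeriv hab hK
  rw [Nat.sub_add_cancel hk] at hjet
  have hN := kernelNorm_nonneg a b k K
  have hKc := hK.1.continuousOn
  have hcl : closure (Set.Ioo a b ×ˢ Set.Ioo a b) = Set.Icc a b ×ˢ Set.Icc a b := by
    rw [closure_prod_eq, closure_Ioo hab.ne]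
  refine norm_nystromDet_sub_fredholmDet_le hab hpos hν.sum_weights hKc (fun p hp => ?_)
    (fun m J t ht => ?_) z
  · rw [← hcl] at hp hKc
    refine le_on_closure (fun q hq => ?_) hKc.norm continuousOn_const hp
    exact hjet.bound 0 0 (Nat.zero_le _) q.1 hq.1 q.2 hq.2
  · have hd := hjet.diffLip_det (m := m) (fun p => ht p trivial) J (i := 0) (j := 0)
      (r := k - 1) (by omega)
    rw [Nat.sub_add_cancel hk] at hd
    simp only [← kernelDet_update_eq_det_jetMatrix] at hd
    have hc : ContinuousOn (fun s => kernelDet K m (Function.update t J s)) (Set.Icc a b) := by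
      simp only [kernelDet, Matrix.det_apply', Matrix.of_apply]
      refine continuousOn_finsetSum _ fun σ _ => continuousOn_const.mul
        (continuousOn_finsetProd _ fun p _ => ?_)
      have hmem : ∀ s ∈ Set.Icc a b, ∀ q, Function.update t J s q ∈ Set.Icc a b := by
        intro s hs q
        rcases eq_or_ne q J with rfl | hq
        · simpa using hs
        · simpa [hq] using Set.Ioo_subset_Icc_self (ht q trivial)
      exact hKc.comp (f := fun s => (Function.update t J s (σ p), Function.update t J s p))
        (Continuous.continuousOn (by fun_prop)) fun s hs => ⟨hmem s hs _, hmem s hs _⟩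
    refine (norm_apply_sub_integral_le_of_diffLip hab hpos hν hk hkν hc (by positivity) hd).trans
      (le_of_eq ?_)
    rw [pow_succ]
    ring

/-! ### Chebyshev expansion in an ellipse -/

instance fact_two_pi_pos : Fact (0 < 2 * Real.pi) := ⟨Real.two_pi_pos⟩

/-- The Laurent coefficients of a function which is holomorphic and bounded by `M` in an annulus
containing `1 ≤ |w| ≤ r`. -/
theorem norm_fourierCoeff_le {G : ℂ → ℂ} {r M : ℝ} (hr : 1 < r)
    (hG : ∀ w : ℂ, 1 ≤ ‖w‖ → ‖w‖ ≤ r → DifferentiableAt ℂ G w ∧ ‖G w‖ ≤ M) (n : ℕ) :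
    ‖fourierCoeff (T := 2 * Real.pi) (fun x => G (fourier 1 x)) n‖ ≤ M * (r⁻¹) ^ n := by
  have hr0 : 0 < r := zero_lt_one.trans hr
  have h1 : ∮ w in C(0, 1), (w ^ (n + 1))⁻¹ * G w
      = ∫ x in (0 : ℝ)..2 * Real.pi, Complex.I *
        (fourier (T := 2 * Real.pi) (-(n : ℤ)) (x : AddCircle (2 * Real.pi)) • G (fourier (T := 2 * Real.pi) 1 (x : AddCircle (2 * Real.pi)))) := by
    rw [circleIntegral]
    refine intervalIntegral.integral_congr fun x _ => ?_
    have e1 : (fourier (T := 2 * Real.pi) 1 (x : AddCircle (2 * Real.pi)) : ℂ)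
        = Complex.exp (x * Complex.I) := by
      rw [fourier_coe_apply]
      congr 1
      have : (Real.pi : ℂ) ≠ 0 := by exact_mod_cast Real.pi_ne_zero
      push_cast
      field_simp
    have e2 : (fourier (T := 2 * Real.pi) (-(n : ℤ)) (x : AddCircle (2 * Real.pi)) : ℂ)
        = (Complex.exp (x * Complex.I) ^ n)⁻¹ := by
      rw [fourier_coe_apply, ← Complex.exp_nat_mul, ← Complex.exp_neg]
      congr 1
      have : (Real.pi : ℂ) ≠ 0 := by exact_mod_cast Real.pi_ne_zero
      push_cast
      field_simp
    have e3 := Complex.exp_ne_zero (x * Complex.I)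
    simp only [e1, e2, deriv_circleMap, circleMap_zero, Complex.ofReal_one, one_mul, smul_eq_mul]
    field_simp
    ring
  -- Cauchy's theorem moves the contour out to radius `r`, where `w^{-(n+1)}` supplies the decay.
  have h2 : ∮ w in C(0, r), (w ^ (n + 1))⁻¹ * G w = ∮ w in C(0, 1), (w ^ (n + 1))⁻¹ * G w := by
    have hd : ∀ w : ℂ, 1 ≤ ‖w‖ → ‖w‖ ≤ r →
        DifferentiableAt ℂ (fun w => (w ^ (n + 1))⁻¹ * G w) w := fun w h1 h2 => by
      have hw : w ≠ 0 := norm_pos_iff.1 (zero_lt_one.trans_le h1)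
      exact ((differentiableAt_id.pow _).inv (pow_ne_zero _ hw)).mul (hG w h1 h2).1
    refine Complex.circleIntegral_eq_of_differentiable_on_annulus_off_countable zero_lt_one hr.le
      Set.countable_empty (fun w hw => ?_) (fun w hw => ?_)
    · simp only [Set.mem_sdiff, mem_closedBall_zero_iff, mem_ball_zero_iff, not_lt] at hw
      exact (hd w hw.2 hw.1).continuousAt.continuousWithinAt
    · simp only [Set.mem_sdiff, mem_closedBall_zero_iff, mem_ball_zero_iff, not_le] at hw
      exact hd w hw.1.2.le hw.1.1.le
  have h3 : ‖∮ w in C(0, r), (w ^ (n + 1))⁻¹ * G w‖ ≤ 2 * Real.pi * r * ((r ^ (n + 1))⁻¹ * M) := by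
    refine circleIntegral.norm_integral_le_of_norm_le_const hr0.le fun w hw => ?_
    rw [mem_sphere_zero_iff_norm] at hw
    rw [norm_mul, norm_inv, norm_pow, hw]
    exact mul_le_mul_of_nonneg_left (hG w (hw ▸ hr.le) hw.le).2 (by positivity)
  rw [h2, h1, intervalIntegral.integral_const_mul, norm_mul, Complex.norm_I, one_mul] at h3
  rw [fourierCoeff_eq_intervalIntegral _ _ 0, zero_add, norm_smul, Real.norm_of_nonneg
    (by positivity)]
  calc _ ≤ 1 / (2 * Real.pi) * (2 * Real.pi * r * ((r ^ (n + 1))⁻¹ * M)) :=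
        mul_le_mul_of_nonneg_left h3 (by positivity)
    _ = _ := by
        have := Real.pi_ne_zero
        rw [pow_succ, inv_pow]
        field_simp

theorem fourierCoeff_neg_of_even {f : AddCircle (2 * Real.pi) → ℂ} (hf : ∀ x, f (-x) = f x)
    (n : ℤ) : fourierCoeff f (-n) = fourierCoeff f n := by
  unfold fourierCoeff
  rw [← integral_neg_eq_self]
  refine integral_congr_ae (Filter.Eventually.of_forall fun x => ?_)
  simp only [hf, neg_neg, fourier_apply, smul_neg, neg_smul]

/-- The truncated Chebyshev expansion of a function `g` with `g ((w + w⁻¹) / 2)` holomorphic in an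
annulus. -/
theorem exists_polynomial_approx_of_annulus {g G : ℂ → ℂ} {r M : ℝ} (hr : 1 < r)
    (hG : ∀ w : ℂ, 1 ≤ ‖w‖ → ‖w‖ ≤ r → DifferentiableAt ℂ G w ∧ ‖G w‖ ≤ M)
    (hinv : ∀ w, G w⁻¹ = G w) (hg : ∀ θ : ℝ, G (Complex.exp (θ * Complex.I)) = g (Real.cos θ))
    {ν : ℕ} (hν : 1 ≤ ν) :
    ∃ p : Polynomial ℂ, p.natDegree ≤ ν - 1 ∧ ∀ x ∈ Set.Icc (-1 : ℝ) 1,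
      ‖g x - p.eval (x : ℂ)‖ ≤ 2 * M * ((r⁻¹) ^ ν / (1 - r⁻¹)) := by
  have hr0 : 0 < r := zero_lt_one.trans hr
  have hr1 : r⁻¹ < 1 := inv_lt_one_of_one_lt₀ hr
  have hri : 0 ≤ r⁻¹ := by positivity
  have hnorm : ∀ x : AddCircle (2 * Real.pi), ‖(fourier 1 x : ℂ)‖ = 1 := fun x => by
    rw [fourier_apply]; exact Circle.norm_coe _
  set f : C(AddCircle (2 * Real.pi), ℂ) := ⟨fun x => G (fourier 1 x), by
    refine continuous_iff_continuousAt.2 fun x => ?_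
    exact ContinuousAt.comp (g := G) (hG _ (hnorm x).ge ((hnorm x).trans_le hr.le)).1.continuousAt
      (fourier 1).continuous.continuousAt⟩ with hf
  have heven : ∀ x, f (-x) = f x := fun x => by
    change G (fourier 1 (-x)) = G (fourier 1 x)
    rw [← hinv (fourier 1 x)]
    congr 1
    simp [fourier_apply, AddCircle.toCircle_neg]
  set α : ℕ → ℂ := fun n => fourierCoeff f n
  have hα : ∀ n : ℕ, ‖α n‖ ≤ M * (r⁻¹) ^ n := norm_fourierCoeff_le hr hG
  have hαneg : ∀ n : ℕ, fourierCoeff f (-(n : ℤ)) = α n := fun n =>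
    fourierCoeff_neg_of_even heven n
  have hgeom : Summable fun n : ℕ => M * (r⁻¹) ^ n :=
    (summable_geometric_of_lt_one hri hr1).mul_left M
  have hsum : Summable (fourierCoeff f) := by
    refine Summable.of_nat_of_neg (.of_norm_bounded hgeom hα) (.of_norm_bounded hgeom fun n => ?_)
    rw [hαneg]
    exact hα n
  -- `τ n` joins the equal coefficients at `n` and `-n`. For `n = 0` this counts the constant twice,
  -- hence the subtraction of `α 0`.
  set τ : ℕ → Polynomial ℂ := fun n => Polynomial.C (2 * α n) * Polynomial.Chebyshev.T ℂ n
  refine ⟨∑ n ∈ Finset.range ν, τ n - Polynomial.C (α 0), ?_, fun x hx => ?_⟩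
  · refine (Polynomial.natDegree_sub_le _ _).trans (max_le ?_ (by simp))
    refine Polynomial.natDegree_sum_le_of_forall_le _ _ fun n hn => ?_
    refine (Polynomial.natDegree_C_mul_le _ _).trans ?_
    rw [Polynomial.Chebyshev.natDegree_T]
    have := Finset.mem_range.1 hn
    omega
  obtain ⟨θ, rfl⟩ : ∃ θ, Real.cos θ = x := ⟨Real.arccos x, Real.cos_arccos hx.1 hx.2⟩
  have hexp : ∀ n : ℤ, (fourier (T := 2 * Real.pi) n (θ : AddCircle (2 * Real.pi)) : ℂ)
      = Complex.exp (n * θ * Complex.I) := by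
    intro n
    rw [fourier_coe_apply]
    congr 1
    have : (Real.pi : ℂ) ≠ 0 := by exact_mod_cast Real.pi_ne_zero
    push_cast
    field_simp
  have hfθ : f (θ : AddCircle (2 * Real.pi)) = g (Real.cos θ) := by
    rw [← hg]
    change G _ = _
    rw [hexp]
    simp
  have hs := (has_pointwise_sum_fourier_series_of_summable hsum
    (θ : AddCircle (2 * Real.pi))).nat_add_neg
  have hterm : ∀ n : ℕ, (fourierCoeff f (n : ℤ) • fourier (n : ℤ) (θ : AddCircle (2 * Real.pi))
      + fourierCoeff f (-(n : ℤ)) • fourier (-(n : ℤ)) (θ : AddCircle (2 * Real.pi)) : ℂ)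
      = (τ n).eval ((Real.cos θ : ℝ) : ℂ) := by
    intro n
    rw [hαneg, hexp, hexp]
    simp only [τ, Polynomial.eval_mul, Polynomial.eval_C, Complex.ofReal_cos,
      Polynomial.Chebyshev.T_complex_cos, smul_eq_mul, α]
    have := Complex.two_cos (n * θ)
    push_cast
    simp only [neg_mul] at this ⊢
    linear_combination -fourierCoeff f n * this
  simp only [hterm] at hs
  have h0 : fourierCoeff f 0 • (fourier 0 (θ : AddCircle (2 * Real.pi)) : ℂ) = α 0 := by
    simp [α]
  rw [h0, hfθ] at hs
  have hs' := (hasSum_nat_add_iff' ν).2 hs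
  have hdiff : g (Real.cos θ) - (∑ n ∈ Finset.range ν, τ n - Polynomial.C (α 0)).eval
      ((Real.cos θ : ℝ) : ℂ) = ∑' n, (τ (n + ν)).eval ((Real.cos θ : ℝ) : ℂ) := by
    rw [hs'.tsum_eq, Polynomial.eval_sub, Polynomial.eval_finsetSum, Polynomial.eval_C]
    ring
  rw [hdiff]
  have htail : HasSum (fun n : ℕ => 2 * M * (r⁻¹) ^ ν * (r⁻¹) ^ n)
      (2 * M * ((r⁻¹) ^ ν / (1 - r⁻¹))) := by
    have := (hasSum_geometric_of_lt_one hri hr1).mul_left (2 * M * (r⁻¹) ^ ν)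
    rwa [← div_eq_mul_inv, mul_div_assoc] at this
  refine tsum_of_norm_bounded htail fun n => ?_
  simp only [τ, Polynomial.eval_mul, Polynomial.eval_C, Complex.ofReal_cos,
    Polynomial.Chebyshev.T_complex_cos, norm_mul, Complex.norm_ofNat]
  have hcos : ‖Complex.cos (((n + ν : ℕ) : ℤ) * θ)‖ ≤ 1 := by
    have : ((((n + ν : ℕ) : ℤ) : ℂ) * θ) = ((((n + ν : ℕ) : ℝ) * θ : ℝ) : ℂ) := by push_cast; rfl
    rw [this, ← Complex.ofReal_cos, Complex.norm_real]
    exact Real.abs_cos_le_one _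
  calc 2 * ‖α (n + ν)‖ * ‖Complex.cos (((n + ν : ℕ) : ℤ) * θ)‖
      ≤ 2 * (M * (r⁻¹) ^ (n + ν)) * 1 :=
        mul_le_mul (mul_le_mul_of_nonneg_left (hα _) two_pos.le) hcos (norm_nonneg _)
          (mul_nonneg two_pos.le ((norm_nonneg _).trans (hα _)))
    _ = _ := by rw [pow_add]; ring

/-! ### Kernels which are analytic in an ellipse -/

theorem isOpen_ellipse (a b s σ : ℝ) : IsOpen (ellipse a b s σ) :=
  isOpen_lt (by fun_prop) continuous_const

theorem ofReal_mem_ellipse {a b s σ : ℝ} (hσ : 0 < σ) (hσs : σ < s)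
    (hfoci : s ^ 2 - σ ^ 2 = ((b - a) / 2) ^ 2) {x : ℝ} (hx : x ∈ Set.Icc a b) :
    (x : ℂ) ∈ ellipse a b s σ := by
  have hs : 0 < s := hσ.trans hσs
  simp only [ellipse, Set.mem_ofPred_eq, Complex.ofReal_re, Complex.ofReal_im, zero_div]
  rw [div_pow, zero_pow two_ne_zero, add_zero, div_lt_one (by positivity)]
  nlinarith [mul_nonneg (sub_nonneg.2 hx.1) (sub_nonneg.2 hx.2)]

/-- The circle of radius `r` goes to the confocal ellipse with semiaxes `(b - a) / 2` times `(r ±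
r⁻¹) / 2`, and both increase with `r`. -/
theorem joukowski_mem_ellipse {a b s σ ρ : ℝ} (hab : a < b) (hρ : 1 < ρ)
    (hs : s = (b - a) / 2 * ((ρ + ρ⁻¹) / 2)) (hσ : σ = (b - a) / 2 * ((ρ - ρ⁻¹) / 2)) {w : ℂ}
    (h1 : 1 ≤ ‖w‖) (h2 : ‖w‖ < ρ) :
    ((a + b) / 2 : ℝ) + ((b - a) / 2 : ℝ) * ((w + w⁻¹) / 2) ∈ ellipse a b s σ := by
  have hba : 0 < b - a := sub_pos.2 hab
  set r := ‖w‖ with hr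
  have hr0 : 0 < r := zero_lt_one.trans_le h1
  have hρ0 : 0 < ρ := zero_lt_one.trans hρ
  have hrsq : r ^ 2 = w.re ^ 2 + w.im ^ 2 := by
    rw [hr, Complex.sq_norm, Complex.normSq_apply]; ring
  have hinv : ρ⁻¹ < r⁻¹ := inv_strictAnti₀ hr0 h2
  have hρ1 : ρ⁻¹ < 1 := inv_lt_one_of_one_lt₀ hρ
  have hr1 : r⁻¹ ≤ 1 := inv_le_one_of_one_le₀ h1
  have hrr : r * r⁻¹ = 1 := mul_inv_cancel₀ hr0.ne'
  have hρρ : ρ * ρ⁻¹ = 1 := mul_inv_cancel₀ hρ0.ne'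
  have hplus : r + r⁻¹ < ρ + ρ⁻¹ := by
    have h : ρ + ρ⁻¹ - (r + r⁻¹) = (ρ - r) * (1 - ρ⁻¹ * r⁻¹) := by
      linear_combination (-ρ⁻¹) * hrr + r⁻¹ * hρρ
    have : ρ⁻¹ * r⁻¹ < 1 := by
      calc ρ⁻¹ * r⁻¹ ≤ ρ⁻¹ * 1 := by gcongr
        _ < 1 := by rwa [mul_one]
    nlinarith [mul_pos (sub_pos.2 h2) (sub_pos.2 this)]
  have hminus : r - r⁻¹ < ρ - ρ⁻¹ := by linarith
  have hminus0 : 0 ≤ r - r⁻¹ := by linarith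
  have hσ0 : 0 < ρ - ρ⁻¹ := by linarith
  have hs0 : 0 < ρ + ρ⁻¹ := by positivity
  have hre : (((a + b) / 2 : ℝ) + ((b - a) / 2 : ℝ) * ((w + w⁻¹) / 2) : ℂ).re - (a + b) / 2
      = (b - a) / 2 * ((r + r⁻¹) / 2) * (w.re / r) := by
    have : (w⁻¹).re = w.re * (r⁻¹) ^ 2 := by
      rw [Complex.inv_re, Complex.normSq_eq_norm_sq, inv_pow, div_eq_mul_inv]
    rw [Complex.add_re, Complex.ofReal_re, Complex.re_ofReal_mul, Complex.div_ofNat_re,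
      Complex.add_re, this]
    linear_combination (-(b - a) / 4 * w.re) * hrr
  have him : (((a + b) / 2 : ℝ) + ((b - a) / 2 : ℝ) * ((w + w⁻¹) / 2) : ℂ).im
      = (b - a) / 2 * ((r - r⁻¹) / 2) * (w.im / r) := by
    have : (w⁻¹).im = -w.im * (r⁻¹) ^ 2 := by
      rw [Complex.inv_im, Complex.normSq_eq_norm_sq, inv_pow, div_eq_mul_inv]
    rw [Complex.add_im, Complex.ofReal_im, Complex.im_ofReal_mul, Complex.div_ofNat_im,
      Complex.add_im, this]
    linear_combination (-(b - a) / 4 * w.im) * hrr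
  simp only [ellipse, Set.mem_ofPred_eq]
  rw [hre, him, hs, hσ]
  have e1 : (b - a) / 2 * ((r + r⁻¹) / 2) * (w.re / r) / ((b - a) / 2 * ((ρ + ρ⁻¹) / 2))
      = (r + r⁻¹) / (ρ + ρ⁻¹) * (w.re / r) := by field_simp
  have e2 : (b - a) / 2 * ((r - r⁻¹) / 2) * (w.im / r) / ((b - a) / 2 * ((ρ - ρ⁻¹) / 2))
      = (r - r⁻¹) / (ρ - ρ⁻¹) * (w.im / r) := by field_simp
  rw [e1, e2, mul_pow, mul_pow]
  have f1 : ((r + r⁻¹) / (ρ + ρ⁻¹)) ^ 2 < 1 :=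
    pow_lt_one₀ (by positivity) ((div_lt_one hs0).2 hplus) two_ne_zero
  have f2 : ((r - r⁻¹) / (ρ - ρ⁻¹)) ^ 2 < 1 :=
    pow_lt_one₀ (div_nonneg hminus0 hσ0.le) ((div_lt_one hσ0).2 hminus) two_ne_zero
  have f3 : (w.re / r) ^ 2 + (w.im / r) ^ 2 = 1 := by
    rw [div_pow, div_pow, ← add_div, ← hrsq, div_self (by positivity)]
  -- A convex combination of two numbers below `1`; strictness needs to know which weight is
  -- positive.
  rcases (sq_nonneg (w.re / r)).eq_or_lt with h0 | h0
  · rw [← h0] at f3 ⊢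
    nlinarith
  · nlinarith [sq_nonneg (w.im / r), mul_pos h0 (sub_pos.2 f1),
      mul_nonneg (sq_nonneg (w.im / r)) (sub_pos.2 f2).le]

/-- The quadrature error for functions which are holomorphic and bounded in an ellipse. -/
theorem norm_apply_sub_integral_le_of_ellipse {a b s σ ρ : ℝ} (hab : a < b) (hσ : 0 < σ)
    (hσs : σ < s) (hfoci : s ^ 2 - σ ^ 2 = ((b - a) / 2) ^ 2)
    (hρ : ρ = Real.sqrt ((s + σ) / (s - σ))) {F : ℂ → ℂ} {M : ℝ}
    (hF : DifferentiableOn ℂ F (ellipse a b s σ)) (hM : ∀ ζ ∈ ellipse a b s σ, ‖F ζ‖ ≤ M)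
    {Q : QuadratureRule a b} (hpos : Q.PositiveWeights) {ν : ℕ} (hν : Q.HasOrder ν) :
    ‖Q.apply (fun x => F x) - ∫ t in a..b, F t‖
      ≤ (b - a) * (4 * (ρ ^ ν)⁻¹ / (1 - ρ⁻¹) * M) := by
  have hba : 0 < b - a := sub_pos.2 hab
  have hsσ : 0 < s - σ := sub_pos.2 hσs
  have hs0 : 0 < s := hσ.trans hσs
  have hρ1 : 1 < ρ := by
    rw [hρ, Real.lt_sqrt zero_le_one, one_pow, one_lt_div hsσ]
    linarith
  have hρ0 : 0 < ρ := zero_lt_one.trans hρ1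
  have hρsq : ρ ^ 2 * (s - σ) = s + σ := by
    rw [hρ, Real.sq_sqrt (by positivity), div_mul_cancel₀ _ hsσ.ne']
  set h := (b - a) / 2 with hh
  have hh0 : 0 < h := by positivity
  have hplus : s + σ = h * ρ := by
    have : (s + σ) ^ 2 = (h * ρ) ^ 2 := by
      linear_combination (-(s + σ)) * hρsq + ρ ^ 2 * hfoci
    exact (pow_left_inj₀ (by positivity) (by positivity) two_ne_zero).1 this
  have hminus : s - σ = h * ρ⁻¹ := by
    have : ρ * (s - σ) = h := by
      apply mul_left_cancel₀ hρ0.ne'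
      linear_combination hρsq + hplus
    rw [← this]; field_simp
  have hs' : s = h * ((ρ + ρ⁻¹) / 2) := by linear_combination (hplus + hminus) / 2
  have hσ' : σ = h * ((ρ - ρ⁻¹) / 2) := by linear_combination (hplus - hminus) / 2
  set c := (a + b) / 2 with hc
  have hEo := isOpen_ellipse a b s σ
  have hFc : ContinuousOn (fun x : ℝ => F x) (Set.Icc a b) :=
    hF.continuousOn.comp Complex.continuous_ofReal.continuousOn fun x hx =>
      ofReal_mem_ellipse hσ hσs hfoci hx
  -- `F` is controlled only inside the open ellipse, so the estimate is made for `r < ρ` and then `r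
  -- → ρ`. The factor `4` is `2` from the paired coefficients times `2` from the quadrature bound.
  have key : ∀ r : ℝ, 1 < r → r < ρ → ‖Q.apply (fun x => F x) - ∫ t in a..b, F t‖
      ≤ (b - a) * (2 * (2 * M * ((r⁻¹) ^ ν / (1 - r⁻¹)))) := by
    intro r hr hrρ
    set J : ℂ → ℂ := fun w => (c : ℂ) + (h : ℂ) * ((w + w⁻¹) / 2)
    obtain ⟨p, hp, hpa⟩ := exists_polynomial_approx_of_annulus
      (g := fun y => F (c + h * y)) (G := fun w => F (J w)) (M := M) hr
      (fun w h1 h2 => by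
        have hmem : J w ∈ ellipse a b s σ :=
          joukowski_mem_ellipse hab hρ1 hs' hσ' h1 (h2.trans_lt hrρ)
        have hw : w ≠ 0 := norm_pos_iff.1 (zero_lt_one.trans_le h1)
        refine ⟨DifferentiableAt.comp w (hF.differentiableAt (hEo.mem_nhds hmem)) ?_, hM _ hmem⟩
        have := differentiableAt_inv (𝕜 := ℂ) hw
        fun_prop)
      (fun w => by simp only [J, inv_inv, add_comm w⁻¹])
      (fun θ => by
        simp only [J, ← Complex.exp_neg, Complex.ofReal_cos, Complex.cos, neg_mul]) hν.1
    refine norm_apply_sub_integral_le_of_approx hab.le hpos hν hFc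
      ((natDegree_comp_affine_le p (h : ℂ)⁻¹ (-(c / h : ℝ) : ℂ)).trans hp) fun x hx => ?_
    have hy : (x - c) / h ∈ Set.Icc (-1 : ℝ) 1 := by
      rw [Set.mem_Icc, le_div_iff₀ hh0, div_le_iff₀ hh0, hh, hc]
      constructor <;> linarith [hx.1, hx.2]
    have := hpa _ hy
    have e1 : (c : ℂ) + h * (((x - c) / h : ℝ) : ℂ) = x := by
      have : (h : ℂ) ≠ 0 := by exact_mod_cast hh0.ne'
      push_cast; field_simp; ring
    have e2 : (h : ℂ)⁻¹ * (x : ℂ) + (-(c / h : ℝ) : ℂ) = (((x - c) / h : ℝ) : ℂ) := by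
      push_cast; ring
    simp only [e1] at this
    simpa only [Polynomial.eval_comp, Polynomial.eval_add, Polynomial.eval_mul, Polynomial.eval_C,
      Polynomial.eval_X, e2] using this
  have hlim : Filter.Tendsto (fun r : ℝ => (b - a) * (2 * (2 * M * ((r⁻¹) ^ ν / (1 - r⁻¹)))))
      (nhdsWithin ρ (Set.Iio ρ)) (nhds ((b - a) * (2 * (2 * M * ((ρ⁻¹) ^ ν / (1 - ρ⁻¹)))))) := by
    refine Filter.Tendsto.mono_left (ContinuousAt.tendsto ?_) nhdsWithin_le_nhds
    have h1 : ContinuousAt (fun r : ℝ => r⁻¹) ρ := continuousAt_inv₀ hρ0.ne'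
    have h2 : 1 - ρ⁻¹ ≠ 0 := (sub_pos.2 (inv_lt_one_of_one_lt₀ hρ1)).ne'
    exact continuousAt_const.mul (continuousAt_const.mul (continuousAt_const.mul
      ((h1.pow ν).div (continuousAt_const.sub h1) h2)))
  have := ge_of_tendsto hlim (Filter.eventually_of_mem (Ioo_mem_nhdsLT hρ1)
    fun r hr => key r hr.1 hr.2)
  refine this.trans (le_of_eq ?_)
  rw [inv_pow]
  ring

theorem norm_nystromDet_sub_fredholmDet_le_of_analytic {a b s σ ρ : ℝ} (hab : a < b) (hσ : 0 < σ)
    (hσs : σ < s) (hfoci : s ^ 2 - σ ^ 2 = ((b - a) / 2) ^ 2)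
    (hρ : ρ = Real.sqrt ((s + σ) / (s - σ))) {K : ℂ × ℂ → ℂ}
    (hK : AnalyticOnNhd ℂ K (ellipse a b s σ ×ˢ ellipse a b s σ))
    (hbdd : ∃ M : ℝ, ∀ p ∈ ellipse a b s σ ×ˢ ellipse a b s σ, ‖K p‖ ≤ M)
    {Q : QuadratureRule a b} (hpos : Q.PositiveWeights) {ν : ℕ} (hν : Q.HasOrder ν) (z : ℂ) :
    ‖Q.nystromDet (fun p : ℝ × ℝ => K ((p.1 : ℂ), (p.2 : ℂ))) z
        - fredholmDet a b (fun p : ℝ × ℝ => K ((p.1 : ℂ), (p.2 : ℂ))) z‖ ≤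
      4 * (ρ ^ ν)⁻¹ / (1 - ρ⁻¹) *
        Phi (‖z‖ * (b - a) * (linftyENorm K (ellipse a b s σ ×ˢ ellipse a b s σ)).toReal) := by
  set E := ellipse a b s σ with hE
  have hEo : IsOpen E := isOpen_ellipse a b s σ
  set N := (linftyENorm K (E ×ˢ E)).toReal with hN
  have hKd : DifferentiableOn ℂ K (E ×ˢ E) := hK.differentiableOn
  -- By continuity the essential supremum bounds `K` at every point; boundedness keeps it finite.
  have hKN : ∀ p ∈ E ×ˢ E, ‖K p‖ ≤ N := by
    obtain ⟨M, hM⟩ := hbdd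
    refine le_of_ae_le_of_continuousOn (hEo.prod hEo) hKd.continuousOn.norm
      (ae_norm_le_of_linftyENorm_le ENNReal.toReal_nonneg (le_of_eq ?_))
    rw [ENNReal.ofReal_toReal]
    exact ne_top_of_le_ne_top ENNReal.ofReal_ne_top
      (linftyENorm_le (hEo.prod hEo).measurableSet hM)
  have hmem : ∀ x ∈ Set.Icc a b, (x : ℂ) ∈ E := fun x hx => ofReal_mem_ellipse hσ hσs hfoci hx
  refine norm_nystromDet_sub_fredholmDet_le hab hpos hν.sum_weights ?_
    (fun p hp => hKN _ ⟨hmem _ hp.1, hmem _ hp.2⟩) (fun m J t ht => ?_) z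
  · exact hKd.continuousOn.comp (f := fun p : ℝ × ℝ => ((p.1 : ℂ), (p.2 : ℂ)))
      (Continuous.continuousOn (by fun_prop)) fun p hp => ⟨hmem _ hp.1, hmem _ hp.2⟩
  · set u : ℂ → Fin m → ℂ := fun ζ => Function.update (fun p => (t p : ℂ)) J ζ with hu
    have hud : ∀ p, Differentiable ℂ fun ζ => u ζ p := by
      intro p
      rcases eq_or_ne p J with rfl | hp
      · simp only [hu, Function.update_self]; fun_prop
      · simp only [hu, Function.update_of_ne hp]; fun_prop
    have huE : ∀ ζ ∈ E, ∀ p, u ζ p ∈ E := by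
      intro ζ hζ p
      rcases eq_or_ne p J with rfl | hp
      · simpa [hu] using hζ
      · simpa [hu, hp] using hmem _ (Set.Ioo_subset_Icc_self (ht p trivial))
    -- The extension of `K_m` to complex values of its `J`-th variable, the others staying real. All
    -- arguments lie in the ellipse, so Hadamard's bound holds unchanged.
    set F : ℂ → ℂ := fun ζ => (Matrix.of fun p q : Fin m => K (u ζ p, u ζ q)).det with hFdef
    have hFd : DifferentiableOn ℂ F E := by
      simp only [hFdef, Matrix.det_apply', Matrix.of_apply]
      refine DifferentiableOn.fun_sum fun τ _ => (differentiableOn_const _).mul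
        (DifferentiableOn.fun_finsetProd fun p _ => ?_)
      exact hKd.comp (f := fun ζ => (u ζ (τ p), u ζ p))
        ((hud _).prodMk (hud _)).differentiableOn fun ζ hζ => ⟨huE ζ hζ _, huE ζ hζ _⟩
    have hFM : ∀ ζ ∈ E, ‖F ζ‖ ≤ (m : ℝ) ^ ((m : ℝ) / 2) * N ^ m := fun ζ hζ =>
      norm_det_le_pow _ _ fun p q => hKN _ ⟨huE ζ hζ p, huE ζ hζ q⟩
    have hFx : ∀ x : ℝ, kernelDet (fun p : ℝ × ℝ => K ((p.1 : ℂ), (p.2 : ℂ))) m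
        (Function.update t J x) = F x := by
      intro x
      have hux : ∀ p, ((Function.update t J x p : ℝ) : ℂ) = u x p := by
        intro p
        rcases eq_or_ne p J with rfl | hp
        · simp [hu]
        · simp [hu, hp]
      simp only [kernelDet, hFdef, hux]
    simp only [hFx]
    exact norm_apply_sub_integral_le_of_ellipse hab hσ hσs hfoci hρ hFd hFM hpos hν

end NystromFredholm

theorem theorem6p2 :
    (∃ c : ℕ → ℝ, ∀ k : ℕ, 1 ≤ k →
      NystromFredholm.IsQuadratureErrorConstant k (c k) ∧
      ∀ (a b : ℝ), a < b → ∀ K : ℝ × ℝ → ℂ,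
        NystromFredholm.ContDiffLip (k - 1) K (Set.Icc a b ×ˢ Set.Icc a b) →
        ∀ (Q : NystromFredholm.QuadratureRule a b) (ν : ℕ),
          Q.PositiveWeights → Q.HasOrder ν → k ≤ ν → ∀ z : ℂ,
          ‖Q.nystromDet K z - NystromFredholm.fredholmDet a b K z‖ ≤
            c k * 2 ^ k * (b - a) ^ k * ((ν : ℝ) ^ k)⁻¹ *
              NystromFredholm.Phi (‖z‖ * (b - a) * NystromFredholm.kernelNorm a b k K)) ∧
    (∀ (a b s σ ρ : ℝ), a < b → 0 < σ → σ < s → s ^ 2 - σ ^ 2 = ((b - a) / 2) ^ 2 →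
      ρ = Real.sqrt ((s + σ) / (s - σ)) →
      ∀ K : ℂ × ℂ → ℂ,
        AnalyticOnNhd ℂ K
          (NystromFredholm.ellipse a b s σ ×ˢ NystromFredholm.ellipse a b s σ) →
        (∃ M : ℝ, ∀ p ∈ NystromFredholm.ellipse a b s σ ×ˢ NystromFredholm.ellipse a b s σ,
          ‖K p‖ ≤ M) →
        ∀ (Q : NystromFredholm.QuadratureRule a b) (ν : ℕ),
          Q.PositiveWeights → Q.HasOrder ν → ∀ z : ℂ,
          ‖Q.nystromDet (fun p : ℝ × ℝ => K ((p.1 : ℂ), (p.2 : ℂ))) z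
              - NystromFredholm.fredholmDet a b
                  (fun p : ℝ × ℝ => K ((p.1 : ℂ), (p.2 : ℂ))) z‖ ≤
            4 * (ρ ^ ν)⁻¹ / (1 - ρ⁻¹) *
              NystromFredholm.Phi (‖z‖ * (b - a) *
                (NystromFredholm.linftyENorm K
                  (NystromFredholm.ellipse a b s σ ×ˢ
                    NystromFredholm.ellipse a b s σ)).toReal)) := by
  exact ⟨⟨NystromFredholm.quadratureConst, fun k hk =>
    ⟨NystromFredholm.isQuadratureErrorConstant_quadratureConst hk,
      fun a b hab K hK Q ν hpos hν hkν z =>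
        NystromFredholm.norm_nystromDet_sub_fredholmDet_le_of_contDiffLip hab hk hK hpos hν hkν z⟩⟩,
    fun a b s σ ρ hab hσ hσs hfoci hρ K hK hbdd Q ν hpos hν z =>
      NystromFredholm.norm_nystromDet_sub_fredholmDet_le_of_analytic hab hσ hσs hfoci hρ hK hbdd
        hpos hν z⟩
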